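/- Let $n\ge 2$ be even and place $2n$ points equidistantly on the unit circle. Let $\mathcal M_n$ be the set of non-crossing straight-line perfect matchings on these points. Two matchings $M,M'\in\mathcal M_n$ differ in a flip if $M'$ is obtained from $M$ by removing two edges $e,f$ and adding the other two sides of the convex quadrilateral spanned by $e$ and $f$, where no other edge of $M$ meets this quadrilateral; the flip is centered if the closed quadrilateral contains the center of the circle. Let $H_n$ be the graph with vertex set $\mathcal M_n$ in which two matchings are adjacent if and only if they differ in a centered flip, and let $$N_1(n,k)=\frac{2}{n+1}\binom{n+1}{k}\binom{n-2}{k-1}\qquad(1\le k\le n-1).$$ Then every connected component of $H_n$ has at most $N_1(n,n/2)$ vertices. The number of vertices of $H_n$ is the Catalan number $|\mathcal M_n|=C_n=\frac1{n+1}\binom{2n}{n}$, and this bound is asymptotically a $\frac{2}{\sqrt{\pi n}}(1+o(1))$ fraction of it, i.e. $$\frac{N_1(n,n/2)}{|\mathcal M_n|}=\frac{2}{\sqrt{\pi n}}\,(1+o(1))\qquad\text{as } n\to\infty \text{ through even integers}.$$ -/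

import Mathlib

open Filter Asymptotics

/-- The `2 * n` equidistant points on the unit circle of the plane `ℂ`; the circle center is `0`. -/
noncomputable def circlePoint (n : ℕ) (k : Fin (2 * n)) : ℂ :=
  Complex.exp (2 * Real.pi * Complex.I * ((k : ℕ) : ℂ) / ((2 * n : ℕ) : ℂ))

/-- The closed straight-line segment between the two endpoints of a pair of points. -/
noncomputable def edgeSegment (n : ℕ) (e : Sym2 (Fin (2 * n))) : Set ℂ :=
  convexHull ℝ (circlePoint n '' {k | k ∈ e})

/-- The vertex set of the flip graphs: perfect matchings on the `2 * n` points whose straight-line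
edges are pairwise disjoint. -/
abbrev NCMatching (n : ℕ) : Type :=
  {M : (⊤ : SimpleGraph (Fin (2 * n))).Subgraph //
    M.IsPerfectMatching ∧
      ∀ e ∈ M.edgeSet, ∀ f ∈ M.edgeSet, e ≠ f → Disjoint (edgeSegment n e) (edgeSegment n f)}

/-- The closed quadrilateral spanned by four of the points. -/
noncomputable def quadrilateral (n : ℕ) (a b c d : Fin (2 * n)) : Set ℂ :=
  convexHull ℝ {circlePoint n a, circlePoint n b, circlePoint n c, circlePoint n d}

/-- `M'` arises from `M` by replacing the edges `ab` and `cd` by the edges `bc` and `da`, where no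
other edge of `M` meets the quadrilateral spanned by `ab` and `cd`. The four points are then
automatically distinct, and as `M` and `M'` are both non-crossing, the four edges
`ab`, `bc`, `cd`, `da` are the sides (and not diagonals) of the quadrilateral. -/
def IsFlip {n : ℕ} (M M' : NCMatching n) (a b c d : Fin (2 * n)) : Prop :=
  M.1.edgeSet \ M'.1.edgeSet = {s(a, b), s(c, d)} ∧
  M'.1.edgeSet \ M.1.edgeSet = {s(b, c), s(d, a)} ∧
  ∀ g ∈ M.1.edgeSet ∩ M'.1.edgeSet, Disjoint (edgeSegment n g) (quadrilateral n a b c d)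

/-- Flips can be undone, on the same quadrilateral. -/
theorem IsFlip.reverse {n : ℕ} {M M' : NCMatching n} {a b c d : Fin (2 * n)}
    (h : IsFlip M M' a b c d) : IsFlip M' M b c d a := by
  obtain ⟨h₁, h₂, h₃⟩ := h
  refine ⟨h₂, by rw [h₁, Set.pair_comm], ?_⟩
  have hq : quadrilateral n b c d a = quadrilateral n a b c d := by
    unfold quadrilateral
    congr 1
    ext z
    simp only [Set.mem_insert_iff, Set.mem_singleton_iff]
    tauto
  rw [hq, Set.inter_comm]
  exact h₃

/-- The graph of centered flips: two non-crossing perfect matchings are adjacent if they differ in a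
flip whose closed quadrilateral contains the circle center. -/
def centeredFlipGraph (n : ℕ) : SimpleGraph (NCMatching n) where
  Adj M M' := ∃ a b c d : Fin (2 * n), IsFlip M M' a b c d ∧ (0 : ℂ) ∈ quadrilateral n a b c d
  symm := ⟨by
    rintro M M' ⟨a, b, c, d, h, h0⟩
    refine ⟨b, c, d, a, h.reverse, ?_⟩
    have hq : quadrilateral n b c d a = quadrilateral n a b c d := by
      unfold quadrilateral
      congr 1
      ext z
      simp only [Set.mem_insert_iff, Set.mem_singleton_iff]
      tauto
    rwa [hq]⟩
  loopless := ⟨by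
    rintro M ⟨a, b, c, d, h, -⟩
    have h₁ : s(a, b) ∈ M.1.edgeSet \ M.1.edgeSet := by rw [h.1]; simp
    exact h₁.2 h₁.1⟩

/-- The generalized Narayana number `N_r(n, k) = (r+1)/(n+1) * C(n+1, k) * C(n-r-1, k-1)`, for
`n ≥ 1`, `r ≥ 0` and `1 ≤ k ≤ n - r`. -/
def narayana (r n k : ℕ) : ℚ :=
  ((r : ℚ) + 1) / ((n : ℚ) + 1) * ((n + 1).choose k : ℚ) * ((n - r - 1).choose (k - 1) : ℚ)

/-! Number the points from 0 and read every edge as an arc from its smaller to its larger endpoint.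
Centered flips preserve an integer, the balance: the number of arcs with even left endpoint, plus
the number of arcs longer than `n` with even left endpoint, minus the number of those with odd left
endpoint. Indeed, if the corners of the flipped quadrilateral are `x < y < z < w`, the center forces
`w - x ≥ n` and all other gaps to be at most `n`. Adjacent corners have opposite parity and `n` is
even, so `xw` is the only side longer than `n`, and the weights of `xy`, `zw` and of `yz`, `xw`
agree (`arcWeight_sorted`, `NCMatching.balance_eq_of_adj`). A component therefore lies in one level
set of the balance, and it remains to count level sets.

Matchings correspond to binary trees with `n = 2h` nodes: the left subtree holds the arcs below the
root arc, the right subtree those after it. The balance becomes `leftParityCount true +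
signedHeavyCount h` (`sum_arcWeight_treeArcs`). The first summand has the Narayana distribution. The
second is 0 or 1 (`signedHeavyCount_eq_zero_or_one`), so the generating polynomial of the sum is
linear in it, and `signedHeavySeries_true_eq` solves for the required weighted count. As exactly one
of two subtrees with `2h - 1` nodes in total has at least `h` nodes, this count is half a
coefficient of the square of the Narayana series. With the explicit Narayana numbers
(`coeff_narayanaPoly`), the level sets have sizes `C(n-2, c) * C(n+2, c+2) / (n+1)`
(`coeff_balancePoly`). Both binomials are largest in the middle, where the product is the claimed
bound (`card_filter_balance_le`).

Divided by the Catalan number, the bound is a quotient of central binomial coefficients, to which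
Stirling's formula applies. -/

/-! ### Two statistics of binary trees. -/

section TreeStatistics

open BinaryTree

/-- The number of nodes of a binary tree for which the number of left turns on the path from the
root is even (for `b = true`) or odd (for `b = false`). -/
def leftParityCount : Bool → BinaryTree Unit → ℕ
  | _, .nil => 0
  | b, .node _ l r => (if b then 1 else 0) + leftParityCount (!b) l + leftParityCount b r

/-- The number of nodes whose left subtree has at least `h` nodes, where a node counts `1` or `-1`
according to the parity of the number of left turns on the path from the root. -/
def signedHeavyCount (h : ℕ) : BinaryTree Unit → ℤ
  | .nil => 0
  | .node _ l r =>
    (if h ≤ l.numNodes then 1 else 0) - signedHeavyCount h l + signedHeavyCount h r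

theorem signedHeavyCount_eq_zero {h : ℕ} :
    ∀ T : BinaryTree Unit, T.numNodes ≤ h → signedHeavyCount h T = 0
  | .nil, _ => rfl
  | .node _ l r, hT => by
    simp only [numNodes] at hT
    rw [signedHeavyCount, signedHeavyCount_eq_zero l (by omega),
      signedHeavyCount_eq_zero r (by omega), if_neg (by omega)]
    simp

/-- At most one subtree of the root can contribute. If the left subtree has at least `h` nodes, the
right one is too small, and the value is 1 minus that of the left subtree; otherwise it is the value
of the right subtree. -/
theorem signedHeavyCount_eq_zero_or_one {h : ℕ} :
    ∀ T : BinaryTree Unit, T.numNodes ≤ 2 * h →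
      signedHeavyCount h T = 0 ∨ signedHeavyCount h T = 1
  | .nil, _ => Or.inl rfl
  | .node _ l r, hT => by
    simp only [numNodes] at hT
    have hl := signedHeavyCount_eq_zero_or_one l (h := h) (by omega)
    have hr := signedHeavyCount_eq_zero_or_one r (h := h) (by omega)
    rw [signedHeavyCount]
    by_cases hh : h ≤ l.numNodes
    · rw [signedHeavyCount_eq_zero r (by omega), if_pos hh]
      omega
    · rw [signedHeavyCount_eq_zero l (by omega), if_neg hh]
      omega

end TreeStatistics

/-! ### Generating functions of trees from the decomposition at the root. -/

section GeneratingFunctions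

open BinaryTree PowerSeries

variable {R : Type*} [CommRing R]

/-- The generating function of binary trees by number of nodes, weighted by `f`. -/
noncomputable def treeSeries (f : BinaryTree Unit → R) : R⟦X⟧ :=
  mk fun n => ∑ T ∈ treesOfNumNodesEq n, f T

/-- The generating function of pairs of binary trees by total number of nodes, weighted by `F`. -/
noncomputable def treePairSeries (F : BinaryTree Unit → BinaryTree Unit → R) : R⟦X⟧ :=
  mk fun n => ∑ p ∈ Finset.HasAntidiagonal.antidiagonal n,
    ∑ l ∈ treesOfNumNodesEq p.1, ∑ r ∈ treesOfNumNodesEq p.2, F l r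

theorem sum_treesOfNumNodesEq_succ {M : Type*} [AddCommMonoid M] (f : BinaryTree Unit → M) (n : ℕ) :
    ∑ T ∈ treesOfNumNodesEq (n + 1), f T = ∑ p ∈ Finset.HasAntidiagonal.antidiagonal n,
      ∑ l ∈ treesOfNumNodesEq p.1, ∑ r ∈ treesOfNumNodesEq p.2, f (.node () l r) := by
  rw [treesOfNumNodesEq_succ, Finset.sum_biUnion]
  · refine Finset.sum_congr rfl fun p _ => ?_
    rw [pairwiseNode, Finset.sum_map, Finset.sum_product]
    rfl
  · intro p _ p' _ hpp
    rw [Function.onFun, Finset.disjoint_left]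
    intro T hT hT'
    simp only [pairwiseNode, Finset.mem_map, Finset.mem_product, mem_treesOfNumNodesEq] at hT hT'
    obtain ⟨a, ha, rfl⟩ := hT
    obtain ⟨b, hb, hab⟩ := hT'
    obtain ⟨-, h1, h2⟩ := BinaryTree.node.inj hab
    exact hpp (Prod.ext (by rw [← ha.1, ← h1, hb.1]) (by rw [← ha.2, ← h2, hb.2]))

theorem treeSeries_eq (f : BinaryTree Unit → R) :
    treeSeries f = C (f .nil) + X * treePairSeries fun l r => f (.node () l r) := by
  ext n
  cases n with
  | zero => simp [treeSeries]
  | succ n =>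
    rw [map_add, coeff_succ_X_mul, treeSeries, treePairSeries, coeff_mk, coeff_mk,
      sum_treesOfNumNodesEq_succ, coeff_C, if_neg n.succ_ne_zero, zero_add]

theorem treePairSeries_mul (f g : BinaryTree Unit → R) :
    treePairSeries (fun l r => f l * g r) = treeSeries f * treeSeries g := by
  ext n
  simp only [treePairSeries, treeSeries, coeff_mk, coeff_mul, Finset.sum_mul_sum]

theorem treePairSeries_add (F G : BinaryTree Unit → BinaryTree Unit → R) :
    treePairSeries (fun l r => F l r + G l r) = treePairSeries F + treePairSeries G := by
  ext n
  simp only [treePairSeries, coeff_mk, map_add, Finset.sum_add_distrib]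

theorem treePairSeries_sub (F G : BinaryTree Unit → BinaryTree Unit → R) :
    treePairSeries (fun l r => F l r - G l r) = treePairSeries F - treePairSeries G := by
  ext n
  simp only [treePairSeries, coeff_mk, map_sub, Finset.sum_sub_distrib]

theorem treePairSeries_const_mul (c : R) (F : BinaryTree Unit → BinaryTree Unit → R) :
    treePairSeries (fun l r => c * F l r) = C c * treePairSeries F := by
  ext n
  simp only [treePairSeries, coeff_mk, coeff_C_mul, Finset.mul_sum]

/-- The monomial whose exponent is `leftParityCount b T`. -/
noncomputable def parityWeight (b : Bool) (T : BinaryTree Unit) : Polynomial ℚ :=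
  Polynomial.X ^ leftParityCount b T

/-- The bivariate generating function of binary trees by number of nodes and by
`leftParityCount b`. -/
noncomputable def paritySeries (b : Bool) : (Polynomial ℚ)⟦X⟧ := treeSeries (parityWeight b)

/-- The bivariate generating function of binary trees with at least `h` nodes. -/
noncomputable def heavySeries (h : ℕ) (b : Bool) : (Polynomial ℚ)⟦X⟧ :=
  treeSeries fun T => if h ≤ T.numNodes then parityWeight b T else 0

/-- The bivariate generating function of binary trees, weighted by `signedHeavyCount h`. -/
noncomputable def signedHeavySeries (h : ℕ) (b : Bool) : (Polynomial ℚ)⟦X⟧ :=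
  treeSeries fun T => (signedHeavyCount h T : Polynomial ℚ) * parityWeight b T

theorem parityWeight_true_node (l r : BinaryTree Unit) :
    parityWeight true (.node () l r) =
      Polynomial.X * (parityWeight false l * parityWeight true r) := by
  simp only [parityWeight, leftParityCount]
  simp
  ring

theorem parityWeight_false_node (l r : BinaryTree Unit) :
    parityWeight false (.node () l r) = parityWeight true l * parityWeight false r := by
  simp only [parityWeight, leftParityCount]
  simp
  ring

theorem paritySeries_true :
    paritySeries true = 1 + X * (C Polynomial.X * (paritySeries false * paritySeries true)) := by
  have e := treeSeries_eq (parityWeight true)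
  simp_rw [parityWeight_true_node] at e
  rw [treePairSeries_const_mul, treePairSeries_mul] at e
  rw [show parityWeight true .nil = 1 from pow_zero _, map_one] at e
  exact e

theorem paritySeries_false :
    paritySeries false = 1 + X * (paritySeries true * paritySeries false) := by
  have e := treeSeries_eq (parityWeight false)
  simp_rw [parityWeight_false_node] at e
  rw [treePairSeries_mul] at e
  rw [show parityWeight false .nil = 1 from pow_zero _, map_one] at e
  exact e

/-- The two functional equations contain the same product of series, which cancels. On nonempty
trees the two parity statistics thus have the same distribution up to a shift by one. -/
theorem C_X_mul_paritySeries_false :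
    C Polynomial.X * paritySeries false = paritySeries true - 1 + C Polynomial.X := by
  linear_combination C Polynomial.X * paritySeries_false - paritySeries_true

/-- The generating function of Narayana polynomials is quadratic. -/
theorem paritySeries_true_quadratic :
    paritySeries true =
      1 + X * ((paritySeries true - 1 + C Polynomial.X) * paritySeries true) := by
  rw [← C_X_mul_paritySeries_false, mul_assoc]
  exact paritySeries_true

theorem coeff_heavySeries (h : ℕ) (b : Bool) (n : ℕ) :
    coeff n (heavySeries h b) = if h ≤ n then coeff n (paritySeries b) else 0 := by
  rw [heavySeries, paritySeries, treeSeries, treeSeries, coeff_mk, coeff_mk]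
  have : ∀ T ∈ treesOfNumNodesEq n, (if h ≤ T.numNodes then parityWeight b T else 0) =
      if h ≤ n then parityWeight b T else 0 := by
    intro T hT
    rw [mem_treesOfNumNodesEq.1 hT]
  rw [Finset.sum_congr rfl this]
  split_ifs <;> simp

theorem C_X_mul_heavySeries_false {h : ℕ} (hh : 1 ≤ h) :
    C Polynomial.X * heavySeries h false = heavySeries h true := by
  ext1 n
  rw [coeff_C_mul, coeff_heavySeries, coeff_heavySeries]
  split_ifs with hn
  · have := congrArg (coeff n) C_X_mul_paritySeries_false
    rw [coeff_C_mul, map_add, map_sub, coeff_C, coeff_one, if_neg (by omega),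
      if_neg (by omega)] at this
    rw [this]
    ring
  · simp

theorem signedHeavySeries_true (h : ℕ) :
    signedHeavySeries h true = X * (C Polynomial.X *
      (heavySeries h false * paritySeries true - signedHeavySeries h false * paritySeries true +
        paritySeries false * signedHeavySeries h true)) := by
  have e := treeSeries_eq fun T => (signedHeavyCount h T : Polynomial ℚ) * parityWeight true T
  have : ∀ l r, ((signedHeavyCount h (.node () l r) : ℤ) : Polynomial ℚ) *
      parityWeight true (.node () l r) = Polynomial.X *
      ((if h ≤ l.numNodes then parityWeight false l else 0) * parityWeight true r -
      ((signedHeavyCount h l : Polynomial ℚ) * parityWeight false l) * parityWeight true r +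
      parityWeight false l * ((signedHeavyCount h r : Polynomial ℚ) * parityWeight true r)) := by
    intro l r
    rw [parityWeight_true_node, signedHeavyCount]
    split_ifs <;> push_cast <;> ring
  simp_rw [this] at e
  rw [treePairSeries_const_mul, treePairSeries_add, treePairSeries_sub, treePairSeries_mul,
    treePairSeries_mul, treePairSeries_mul, signedHeavyCount, Int.cast_zero, zero_mul, map_zero, zero_add] at e
  exact e

theorem signedHeavySeries_false (h : ℕ) :
    signedHeavySeries h false = X *
      (heavySeries h true * paritySeries false - signedHeavySeries h true * paritySeries false +
        paritySeries true * signedHeavySeries h false) := by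
  have e := treeSeries_eq fun T => (signedHeavyCount h T : Polynomial ℚ) * parityWeight false T
  have : ∀ l r, ((signedHeavyCount h (.node () l r) : ℤ) : Polynomial ℚ) *
      parityWeight false (.node () l r) =
      (if h ≤ l.numNodes then parityWeight true l else 0) * parityWeight false r -
      ((signedHeavyCount h l : Polynomial ℚ) * parityWeight true l) * parityWeight false r +
      parityWeight true l * ((signedHeavyCount h r : Polynomial ℚ) * parityWeight false r) := by
    intro l r
    rw [parityWeight_false_node, signedHeavyCount]
    split_ifs <;> push_cast <;> ring
  simp_rw [this] at e
  rw [treePairSeries_add, treePairSeries_sub, treePairSeries_mul,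
    treePairSeries_mul, treePairSeries_mul, signedHeavyCount, Int.cast_zero, zero_mul, map_zero, zero_add] at e
  exact e

/-- The right-hand side is the contribution of the roots alone: in the weighted total, all other
nodes cancel. The root decomposition gives a linear system for the two signed series, which this
guess and its analogue for `false` solve, and the system has only one solution. -/
theorem signedHeavySeries_true_eq {h : ℕ} (hh : 1 ≤ h) :
    signedHeavySeries h true = X * (heavySeries h true * paritySeries true) := by
  set N := paritySeries true
  set N' := paritySeries false
  set D := signedHeavySeries h true
  set D' := signedHeavySeries h false
  set A := heavySeries h true
  set t : (Polynomial ℚ)⟦X⟧ := C Polynomial.X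
  have h1 : D = X * (t * (heavySeries h false * N - D' * N + N' * D)) := signedHeavySeries_true h
  have h2 : D' = X * (A * N' - D * N' + N * D') := signedHeavySeries_false h
  have h3 : t * heavySeries h false = A := C_X_mul_heavySeries_false hh
  have h4 : (1 - X * (t * N')) * (D - X * (A * N)) = -(X * (t * N)) * (D' - X * (A * N')) := by
    -- The deviations from the guessed solutions satisfy a homogeneous system.
    linear_combination h1 + X * N * h3
  have h5 : (1 - X * N) * (D' - X * (A * N')) = -(X * N') * (D - X * (A * N)) := by
    linear_combination h2
  have h6 : ((1 - X * N) * (1 - X * (t * N')) - X * X * t * N * N') * (D - X * (A * N)) = 0 := by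
    linear_combination (1 - X * N) * h4 - (X * (t * N)) * h5
  rcases mul_eq_zero.1 h6 with h7 | h7
  -- The determinant of the system has constant coefficient 1, so it is not zero.
  · have := congrArg constantCoeff h7
    simp at this
  · exact sub_eq_zero.1 h7

end GeneratingFunctions

/-! ### Narayana polynomials and their recurrence. -/

section NarayanaPolynomials

open PowerSeries

/-- The generating polynomial of `leftParityCount true` on binary trees with `n` nodes. -/
noncomputable def narayanaPoly (n : ℕ) : Polynomial ℚ := coeff n (paritySeries true)

theorem narayanaPoly_zero : narayanaPoly 0 = 1 := by
  rw [narayanaPoly, paritySeries_true]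
  simp

theorem coeff_paritySeries_true_sq (n : ℕ) :
    coeff n (paritySeries true * paritySeries true) =
      narayanaPoly (n + 1) + (1 - Polynomial.X) * narayanaPoly n := by
  have h := congrArg (coeff (n + 1)) paritySeries_true_quadratic
  rw [map_add, coeff_succ_X_mul, coeff_one, if_neg n.succ_ne_zero, zero_add, add_mul, sub_mul,
    one_mul, map_add, map_sub, coeff_C_mul] at h
  rw [narayanaPoly, narayanaPoly]
  linear_combination -h

theorem narayanaPoly_one : narayanaPoly 1 = Polynomial.X := by
  have h := coeff_paritySeries_true_sq 0
  rw [coeff_mul, Finset.HasAntidiagonal.antidiagonal_zero, Finset.sum_singleton, ← narayanaPoly,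
    narayanaPoly_zero] at h
  linear_combination -h

/-- Completing the square turns the quadratic equation into `y * y = Δ` with `Δ` quadratic in `X`.
Differentiation gives the linear equation `2 * Δ * y' = Δ' * y`, whose coefficients are the
recurrence. -/
theorem coeff_recurrence_of_quadratic {R : Type*} [CommRing R] [IsDomain R] [CharZero R] (t : R)
    {N : R⟦X⟧} (h : N = 1 + X * ((N - 1 + C t) * N)) (n : ℕ) :
    ((n : R) + 3) * coeff (n + 2) N =
      (2 * (n : R) + 3) * (1 + t) * coeff (n + 1) N - (n : R) * (1 - t) ^ 2 * coeff n N := by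
  set y : R⟦X⟧ := C 2 * (X * N) - (1 + X * C (1 - t)) with hy
  set Δ : R⟦X⟧ := 1 - C (2 * (1 + t)) * X + C ((1 - t) ^ 2) * (X * X) with hΔ
  have hsq : y * y = Δ := by
    simp only [hy, hΔ, map_sub, map_mul, map_add, map_pow, map_one, map_ofNat]
    linear_combination (-4 * X) * h
  have hder := congrArg (derivative R) hsq
  rw [Derivation.leibniz, smul_eq_mul] at hder
  set y' := derivative R y with hy'
  have hΔ' : derivative R Δ = C (2 * ((1 - t) ^ 2)) * X - C (2 * (1 + t)) := by
    simp only [hΔ, map_add, map_sub, Derivation.leibniz, smul_eq_mul, derivative_C, derivative_X,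
      derivative_one, map_mul C 2 ((1 - t) ^ 2), map_ofNat C 2]
    ring
  rw [hΔ'] at hder
  have hode : C 2 * (y' - C (2 * (1 + t)) * (X * y') + C ((1 - t) ^ 2) * (X * (X * y'))) =
      C 2 * (C ((1 - t) ^ 2) * (X * y) - C (1 + t) * y) := by
    have : 2 * (Δ * y') = y * (C (2 * ((1 - t) ^ 2)) * X - C (2 * (1 + t))) := by
      rw [← hder, ← hsq]
      ring
    rw [hΔ] at this
    simp only [map_sub, map_mul, map_add, map_pow, map_one, map_ofNat] at this ⊢
    linear_combination this
  have hc := congrArg (coeff (n + 2)) hode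
  rw [coeff_C_mul, coeff_C_mul] at hc
  replace hc := mul_left_cancel₀ two_ne_zero hc
  rw [map_add, map_sub, map_sub, coeff_C_mul, coeff_C_mul, coeff_C_mul, coeff_C_mul,
    coeff_succ_X_mul, coeff_succ_X_mul, coeff_succ_X_mul, coeff_succ_X_mul, hy',
    coeff_derivative, coeff_derivative, coeff_derivative] at hc
  have hyc : ∀ k, coeff (k + 1) y = 2 * coeff k N - if k = 0 then 1 - t else 0 := by
    intro k
    rw [hy, map_sub, map_add, coeff_C_mul, coeff_succ_X_mul, coeff_succ_X_mul, coeff_one, coeff_C,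
      if_neg k.succ_ne_zero, zero_add]
  -- The low-order part of `y` is visible only for `n = 0`, where it enters with the factor `n`.
  have hn : (n : R) * (if n = 0 then 1 - t else 0) = 0 := by
    split_ifs with h
    · rw [h]; simp
    · simp
  rw [hyc, hyc, hyc, if_neg (by omega), if_neg (by omega)] at hc
  push_cast at hc
  refine mul_left_cancel₀ (two_ne_zero (α := R)) ?_
  linear_combination hc + (1 - t) ^ 2 * hn

/-- The three-term recurrence of the Narayana polynomials. -/
theorem narayanaPoly_recurrence (n : ℕ) :
    ((n : Polynomial ℚ) + 3) * narayanaPoly (n + 2) =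
      (2 * (n : Polynomial ℚ) + 3) * (1 + Polynomial.X) * narayanaPoly (n + 1) -
        (n : Polynomial ℚ) * (1 - Polynomial.X) ^ 2 * narayanaPoly n :=
  coeff_recurrence_of_quadratic Polynomial.X paritySeries_true_quadratic n

end NarayanaPolynomials

/-! ### The explicit Narayana numbers. -/

section Binomials

theorem cast_choose_succ_mul (n k : ℕ) :
    (n.choose (k + 1) : ℚ) * (k + 1) = n.choose k * ((n : ℚ) - k) := by
  rcases le_or_gt k n with h | h
  · have := n.choose_succ_right_eq k
    rw [← Nat.cast_sub h]
    exact_mod_cast this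
  · rw [Nat.choose_eq_zero_of_lt h, Nat.choose_eq_zero_of_lt (by omega)]
    simp

theorem cast_choose_succ_eq (n k : ℕ) :
    (n.choose (k + 1) : ℚ) = n.choose k * ((n : ℚ) - k) / (k + 1) := by
  rw [eq_div_iff (by positivity), cast_choose_succ_mul]

/-- The product of a binomial coefficient and its predecessor. -/
def chooseMulPred (n : ℕ) : ℕ → ℚ
  | 0 => 0
  | k + 1 => n.choose (k + 1) * n.choose k

theorem Polynomial.coeff_one_add_X_mul_succ (p : Polynomial ℚ) (k : ℕ) :
    ((1 + Polynomial.X) * p).coeff (k + 1) = p.coeff (k + 1) + p.coeff k := by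
  rw [add_mul, one_mul, Polynomial.coeff_add, Polynomial.coeff_X_mul]

theorem Polynomial.coeff_one_sub_X_mul_succ (p : Polynomial ℚ) (k : ℕ) :
    ((1 - Polynomial.X) * p).coeff (k + 1) = p.coeff (k + 1) - p.coeff k := by
  rw [sub_mul, one_mul, Polynomial.coeff_sub, Polynomial.coeff_X_mul]

theorem Polynomial.coeff_one_add_X_mul_zero (p : Polynomial ℚ) :
    ((1 + Polynomial.X) * p).coeff 0 = p.coeff 0 := by
  simp [add_mul]

theorem Polynomial.coeff_one_sub_X_mul_zero (p : Polynomial ℚ) :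
    ((1 - Polynomial.X) * p).coeff 0 = p.coeff 0 := by
  simp [sub_mul]

/-- Both sides satisfy the three-term recurrence in `n`. With the factor `n` on the left, the
formula needs no division and also covers `n = 0`. -/
theorem coeff_narayanaPoly (n k : ℕ) :
    (n : ℚ) * (narayanaPoly n).coeff k = chooseMulPred n k := by
  induction n using Nat.twoStepInduction generalizing k with
  | zero => cases k <;> simp [chooseMulPred]
  | one =>
    rw [narayanaPoly_one, Polynomial.coeff_X]
    rcases k with _ | _ | k <;> simp [chooseMulPred, Nat.choose_eq_zero_of_lt]
  | more n ih0 ih1 =>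
    have hrec := congrArg (Polynomial.coeff · k) (narayanaPoly_recurrence n)
    have e1 : ((n : Polynomial ℚ) + 3) = Polynomial.C ((n : ℚ) + 3) := by
      rw [map_add, map_natCast, map_ofNat]
    have e2 : (2 * (n : Polynomial ℚ) + 3) = Polynomial.C (2 * (n : ℚ) + 3) := by
      rw [map_add, map_mul, map_natCast, map_ofNat, map_ofNat]
    have e3 : (n : Polynomial ℚ) = Polynomial.C (n : ℚ) := by simp
    rw [e1, e2, e3] at hrec
    simp only [mul_assoc, pow_two, Polynomial.coeff_sub, Polynomial.coeff_C_mul] at hrec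
    have a1 : ∀ k, (narayanaPoly (n + 1)).coeff k = chooseMulPred (n + 1) k / (n + 1) := by
      intro k
      rw [← ih1 k, eq_div_iff (by positivity)]
      push_cast
      ring
    have hn : (n : ℚ) + 3 ≠ 0 := by positivity
    have hn1 : (n : ℚ) + 1 ≠ 0 := by positivity
    have key : ((n : ℚ) + 3) * chooseMulPred (n + 2) k = (n + 2) *
        (((n : ℚ) + 3) * (narayanaPoly (n + 2)).coeff k) → ((n + 2 : ℕ) : ℚ) *
          (narayanaPoly (n + 2)).coeff k = chooseMulPred (n + 2) k := by
      intro h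
      refine mul_left_cancel₀ hn ?_
      rw [h]
      push_cast
      ring
    apply key
    rw [hrec]
    -- The recurrence reaches the coefficient `k - 2`, whose formula involves `choose (k - 3)`. From
    -- 3 on, all binomials are rational multiples of one.
    rcases k with _ | _ | _ | k
    · simp only [Polynomial.coeff_one_add_X_mul_zero, Polynomial.coeff_one_sub_X_mul_zero, ih0, a1]
      simp [chooseMulPred]
    · simp only [Polynomial.coeff_one_sub_X_mul_zero,
        Polynomial.coeff_one_add_X_mul_succ, Polynomial.coeff_one_sub_X_mul_succ, mul_sub, ih0, a1]
      simp [chooseMulPred]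
      field_simp
      ring
    · simp only [Polynomial.coeff_one_add_X_mul_succ, Polynomial.coeff_one_sub_X_mul_succ, mul_sub, ih0, a1]
      simp [chooseMulPred, Nat.choose_succ_succ n 1, cast_choose_succ_eq n 1,
        cast_choose_succ_eq (n+2) 1]
      field_simp
      ring
    · simp only [Polynomial.coeff_one_add_X_mul_succ, Polynomial.coeff_one_sub_X_mul_succ, mul_sub,
        ih0, a1]
      simp only [chooseMulPred, Nat.choose_succ_succ', Nat.cast_add, cast_choose_succ_eq n (k + 2),
        cast_choose_succ_eq n (k + 1), cast_choose_succ_eq n k]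
      push_cast
      have h1 : (k : ℚ) + 1 ≠ 0 := by positivity
      have h2 : (k : ℚ) + 1 + 1 ≠ 0 := by positivity
      have h3 : (k : ℚ) + 2 + 1 ≠ 0 := by positivity
      field_simp
      ring

end Binomials

/-! ### Sizes of the level sets. -/

section ClassSizes

open BinaryTree

/-- The generating polynomial of the statistic `leftParityCount true + signedHeavyCount h`. -/
noncomputable def balancePoly (h n : ℕ) : Polynomial ℚ :=
  ∑ T ∈ treesOfNumNodesEq n,
    parityWeight true T * (1 + (signedHeavyCount h T : Polynomial ℚ) * (Polynomial.X - 1))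

/-- In a pair of sizes with sum `2h - 1`, exactly one is at least `h`. Adding the convolution to its
mirror image removes the size condition and leaves the square of the Narayana series. -/
theorem two_mul_coeff_signedHeavySeries {h : ℕ} (hh : 1 ≤ h) :
    2 * PowerSeries.coeff (2 * h) (signedHeavySeries h true) =
      narayanaPoly (2 * h) + (1 - Polynomial.X) * narayanaPoly (2 * h - 1) := by
  obtain ⟨m, hm⟩ : ∃ m, 2 * h = m + 1 := ⟨2 * h - 1, by omega⟩
  rw [signedHeavySeries_true_eq hh, hm, PowerSeries.coeff_succ_X_mul, Nat.add_sub_cancel,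
    ← coeff_paritySeries_true_sq, PowerSeries.coeff_mul, PowerSeries.coeff_mul, two_mul]
  nth_rw 2 [← Finset.Nat.sum_antidiagonal_swap]
  rw [← Finset.sum_add_distrib]
  refine Finset.sum_congr rfl fun p hp => ?_
  rw [Finset.HasAntidiagonal.mem_antidiagonal] at hp
  simp only [Prod.fst_swap, Prod.snd_swap, coeff_heavySeries]
  by_cases h1 : h ≤ p.1
  · rw [if_pos h1, if_neg (by omega)]
    ring
  · rw [if_neg h1, if_pos (by omega)]
    ring

theorem two_mul_balancePoly {h : ℕ} (hh : 1 ≤ h) :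
    2 * balancePoly h (2 * h) = (1 + Polynomial.X) * narayanaPoly (2 * h) -
      (1 - Polynomial.X) * ((1 - Polynomial.X) * narayanaPoly (2 * h - 1)) := by
  have h1 : balancePoly h (2 * h) = narayanaPoly (2 * h) +
      (Polynomial.X - 1) * PowerSeries.coeff (2 * h) (signedHeavySeries h true) := by
    rw [balancePoly, narayanaPoly, paritySeries, treeSeries, signedHeavySeries, treeSeries,
      PowerSeries.coeff_mk, PowerSeries.coeff_mk, Finset.mul_sum, ← Finset.sum_add_distrib]
    refine Finset.sum_congr rfl fun T _ => ?_
    ring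
  linear_combination 2 * h1 + (Polynomial.X - 1) * two_mul_coeff_signedHeavySeries hh

/-- For `ε` equal to 0 or 1, `1 + ε * (X - 1)` is `X ^ ε`, so every tree contributes a single
monomial. -/
theorem card_filter_eq_coeff_balancePoly (h c : ℕ) :
    (((treesOfNumNodesEq (2 * h)).filter fun T =>
      (leftParityCount true T : ℤ) + signedHeavyCount h T = c).card : ℚ) =
      (balancePoly h (2 * h)).coeff c := by
  rw [Finset.card_filter, balancePoly, Polynomial.finsetSum_coeff, Nat.cast_sum]
  refine Finset.sum_congr rfl fun T hT => ?_
  rw [mem_treesOfNumNodesEq] at hT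
  rcases signedHeavyCount_eq_zero_or_one T hT.le with h0 | h1
  · rw [h0, parityWeight]
    simp only [Int.cast_zero, zero_mul, add_zero, mul_one, Polynomial.coeff_X_pow,
      Nat.cast_inj]
    split_ifs <;> simp_all
  · have : parityWeight true T * (1 + ((1 : ℤ) : Polynomial ℚ) * (Polynomial.X - 1)) =
        Polynomial.X ^ (leftParityCount true T + 1) := by
      rw [parityWeight]
      push_cast
      ring
    rw [h1, this, Polynomial.coeff_X_pow]
    split_ifs <;> first | rfl | omega

theorem coeff_narayanaPoly_succ (n k : ℕ) :
    (narayanaPoly (n + 1)).coeff k = chooseMulPred (n + 1) k / ((n : ℚ) + 1) := by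
  rw [← coeff_narayanaPoly, eq_div_iff (by positivity)]
  push_cast
  ring

theorem two_mul_coeff_balancePoly {m h : ℕ} (hm : 2 * h = m + 2) (c : ℕ) :
    2 * (balancePoly h (m + 2)).coeff c =
      ((1 + Polynomial.X) * narayanaPoly (m + 2)).coeff c -
      ((1 - Polynomial.X) * ((1 - Polynomial.X) * narayanaPoly (m + 1))).coeff c := by
  have e := congrArg (Polynomial.coeff · c) (two_mul_balancePoly (h := h) (by omega))
  have e2 : (2 : Polynomial ℚ) = Polynomial.C 2 := by rw [map_ofNat]
  rw [hm] at e
  simpa only [e2, Polynomial.coeff_sub, Polynomial.coeff_C_mul,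
    show m + 2 - 1 = m + 1 by omega] using e

theorem coeff_balancePoly_of_lt {m h c : ℕ} (hm : 2 * h = m + 2) (hc : c < 2) :
    (balancePoly h (m + 2)).coeff c = 0 := by
  refine mul_left_cancel₀ (two_ne_zero (α := ℚ)) ?_
  rw [two_mul_coeff_balancePoly hm]
  have h1 : (m : ℚ) + 1 ≠ 0 := by positivity
  have h2 : (m : ℚ) + 1 + 1 ≠ 0 := by positivity
  interval_cases c
  · simp only [Polynomial.coeff_one_add_X_mul_zero, Polynomial.coeff_one_sub_X_mul_zero,
      coeff_narayanaPoly_succ]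
    simp [chooseMulPred]
  · simp only [Polynomial.coeff_one_add_X_mul_succ _ 0, Polynomial.coeff_one_sub_X_mul_succ _ 0,
      Polynomial.coeff_one_sub_X_mul_zero, coeff_narayanaPoly_succ]
    simp [chooseMulPred]
    field_simp
    ring

theorem coeff_balancePoly {m h : ℕ} (hm : 2 * h = m + 2) (c : ℕ) :
    ((m : ℚ) + 3) * (balancePoly h (m + 2)).coeff (c + 2) =
      m.choose c * (m + 4).choose (c + 2) := by
  refine mul_left_cancel₀ (two_ne_zero (α := ℚ)) ?_
  rw [mul_left_comm, two_mul_coeff_balancePoly hm]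
  simp only [Polynomial.coeff_one_add_X_mul_succ, Polynomial.coeff_one_sub_X_mul_succ,
    coeff_narayanaPoly_succ]
  rcases c with _ | _ | c
  · simp [chooseMulPred, Nat.choose_succ_succ m 1, cast_choose_succ_eq _ 1]
    field_simp
    ring
  · have h2 : (m.choose 2 : ℚ) = m * (m - 1) / 2 := by
      simpa [one_add_one_eq_two] using cast_choose_succ_eq m 1
    have h3 : (m.choose 3 : ℚ) = m * (m - 1) / 2 * (m - 2) / 3 := by
      have := cast_choose_succ_eq m 2
      rw [h2] at this
      rw [this]
      norm_num
    simp [chooseMulPred, Nat.choose_succ_succ', h2, h3]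
    field_simp
    ring
  · simp only [chooseMulPred, Nat.choose_succ_succ', Nat.cast_add, cast_choose_succ_eq m (c + 3),
        cast_choose_succ_eq m (c + 2), cast_choose_succ_eq m (c + 1), cast_choose_succ_eq m c]
    push_cast
    have h1 : (c : ℚ) + 1 ≠ 0 := by positivity
    have h2 : (c : ℚ) + 1 + 1 ≠ 0 := by positivity
    have h3 : (c : ℚ) + 2 + 1 ≠ 0 := by positivity
    have h4 : (c : ℚ) + 3 + 1 ≠ 0 := by positivity
    field_simp
    ring

theorem narayana_one_two_mul (j : ℕ) :
    narayana 1 (2 * (j + 1)) (j + 1) =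
      ((2 * j).choose j * (2 * j + 4).choose (j + 2) : ℚ) / (2 * j + 3) := by
  have h1 : ((2 * j + 4).choose (j + 2) : ℚ) = 2 * (2 * j + 3).choose (j + 1) := by
    rw [Nat.choose_succ_succ', ← Nat.choose_symm_of_eq_add (a := j + 1) (b := j + 2) (by omega)]
    push_cast
    ring
  rw [narayana, h1, show 2 * (j + 1) + 1 = 2 * j + 3 by ring,
    show 2 * (j + 1) - 1 - 1 = 2 * j by omega, Nat.add_sub_cancel]
  push_cast
  have : (2 * ((j : ℚ) + 1) + 1) ≠ 0 := by positivity
  have : (2 * (j : ℚ) + 3) ≠ 0 := by positivity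
  field_simp
  ring

theorem card_filter_balance_le {h : ℕ} (hh : 1 ≤ h) (c : ℤ) :
    (((treesOfNumNodesEq (2 * h)).filter fun T =>
      (leftParityCount true T : ℤ) + signedHeavyCount h T = c).card : ℚ) ≤
      narayana 1 (2 * h) h := by
  obtain ⟨j, rfl⟩ : ∃ j, h = j + 1 := ⟨h - 1, by omega⟩
  have hpos : 0 ≤ narayana 1 (2 * (j + 1)) (j + 1) := by
    rw [narayana_one_two_mul]
    positivity
  rcases lt_or_ge c 0 with hc | hc
  · rw [Finset.card_eq_zero.2]
    · exact_mod_cast hpos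
    · rw [Finset.filter_eq_empty_iff]
      intro T hT
      rw [mem_treesOfNumNodesEq] at hT
      have := signedHeavyCount_eq_zero_or_one T hT.le
      omega
  · lift c to ℕ using hc
    have hm : 2 * (j + 1) = 2 * j + 2 := by ring
    rw [card_filter_eq_coeff_balancePoly, show (balancePoly (j + 1) (2 * (j + 1))) =
      balancePoly (j + 1) (2 * j + 2) from rfl]
    rcases c with _ | _ | c
    · rw [coeff_balancePoly_of_lt hm (by omega)]
      exact hpos
    · rw [coeff_balancePoly_of_lt hm (by omega)]
      exact hpos
    · have e := coeff_balancePoly hm c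
      rw [narayana_one_two_mul, le_div_iff₀ (by positivity), mul_comm]
      push_cast at e
      rw [e]
      -- The upper indices `2j` and `2j + 4` are even, and both binomials peak at the same `c = j`.
      have h1 := Nat.choose_le_centralBinom c j
      have h2 := Nat.choose_le_centralBinom (c + 2) (j + 2)
      rw [Nat.centralBinom_eq_two_mul_choose] at h1 h2
      rw [show 2 * (j + 2) = 2 * j + 4 by ring] at h2
      exact_mod_cast Nat.mul_le_mul h1 h2

end ClassSizes

/-! ### Chords of the circle: crossing, separation, and position of the center. -/

section CirclePoints

variable {n : ℕ}

theorem circlePoint_eq (k : Fin (2 * n)) :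
    circlePoint n k = Complex.exp (((Real.pi * (k : ℕ) / n : ℝ) : ℂ) * Complex.I) := by
  rw [circlePoint]
  congr 1
  push_cast
  rcases eq_or_ne (n : ℂ) 0 with h | h
  · simp [h]
  · field_simp

theorem circlePoint_re (k : Fin (2 * n)) :
    (circlePoint n k).re = Real.cos (Real.pi * (k : ℕ) / n) := by
  rw [circlePoint_eq, Complex.exp_ofReal_mul_I_re]

theorem circlePoint_im (k : Fin (2 * n)) :
    (circlePoint n k).im = Real.sin (Real.pi * (k : ℕ) / n) := by
  rw [circlePoint_eq, Complex.exp_ofReal_mul_I_im]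

/-- The orthogonal projection to the direction with angle `β`. -/
noncomputable def directionFunctional (β : ℝ) : ℂ →ₗ[ℝ] ℝ :=
  Real.cos β • Complex.reLm + Real.sin β • Complex.imLm

theorem directionFunctional_circlePoint (β : ℝ) (k : Fin (2 * n)) :
    directionFunctional β (circlePoint n k) = Real.cos (Real.pi * (k : ℕ) / n - β) := by
  rw [directionFunctional, Real.cos_sub, ← circlePoint_re, ← circlePoint_im]
  simp
  ring

theorem edgeSegment_mk (i j : Fin (2 * n)) :
    edgeSegment n s(i, j) = segment ℝ (circlePoint n i) (circlePoint n j) := by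
  have : {k | k ∈ s(i, j)} = ({i, j} : Set (Fin (2 * n))) := by
    ext k
    simp
  rw [edgeSegment, this, Set.image_pair, convexHull_pair]

/-- The functional in the direction of the midpoint of the arc is constant on the line through `i`
and `j`. The sine product shows on which side of this line `k` lies. -/
theorem directionFunctional_sub (hn : 0 < n) (i j k : Fin (2 * n)) :
    directionFunctional (Real.pi * ((i : ℕ) + (j : ℕ)) / (2 * n)) (circlePoint n k) -
      Real.cos (Real.pi * ((j : ℕ) - (i : ℕ)) / (2 * n)) =
      -2 * Real.sin (Real.pi * ((k : ℕ) - (i : ℕ)) / (2 * n)) *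
        Real.sin (Real.pi * ((k : ℕ) - (j : ℕ)) / (2 * n)) := by
  have hn' : (n : ℝ) ≠ 0 := by positivity
  rw [directionFunctional_circlePoint, Real.cos_sub_cos]
  have e1 : (Real.pi * (k : ℕ) / n - Real.pi * ((i : ℕ) + (j : ℕ)) / (2 * n) +
      Real.pi * ((j : ℕ) - (i : ℕ)) / (2 * n)) / 2 =
      Real.pi * ((k : ℕ) - (i : ℕ)) / (2 * n) := by
    field_simp
    ring
  have e2 : (Real.pi * (k : ℕ) / n - Real.pi * ((i : ℕ) + (j : ℕ)) / (2 * n) -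
      Real.pi * ((j : ℕ) - (i : ℕ)) / (2 * n)) / 2 =
      Real.pi * ((k : ℕ) - (j : ℕ)) / (2 * n) := by
    field_simp
    ring
  rw [e1, e2]

theorem sin_pos_of_lt {i j : Fin (2 * n)} (h : i < j) :
    0 < Real.sin (Real.pi * ((j : ℕ) - (i : ℕ)) / (2 * n)) := by
  have hj : ((j : ℕ) : ℝ) < 2 * n := by exact_mod_cast j.2
  have hij : ((i : ℕ) : ℝ) < (j : ℕ) := by exact_mod_cast h
  have hi : (0 : ℝ) ≤ (i : ℕ) := by positivity
  have hn : (0 : ℝ) < n := by linarith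
  apply Real.sin_pos_of_pos_of_lt_pi
  · exact div_pos (mul_pos Real.pi_pos (by linarith)) (by linarith)
  · rw [div_lt_iff₀ (by linarith)]
    exact mul_lt_mul_of_pos_left (by linarith) Real.pi_pos

theorem sin_neg_of_lt {i j : Fin (2 * n)} (h : i < j) :
    Real.sin (Real.pi * ((i : ℕ) - (j : ℕ)) / (2 * n)) < 0 := by
  have := sin_pos_of_lt h
  rw [show Real.pi * (((i : ℕ) : ℝ) - (j : ℕ)) / (2 * n) =
    -(Real.pi * ((j : ℕ) - (i : ℕ)) / (2 * n)) by ring, Real.sin_neg]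
  linarith

theorem directionFunctional_lt_of_between (hn : 0 < n) {i j k : Fin (2 * n)} (hi : i < k)
    (hj : k < j) : Real.cos (Real.pi * ((j : ℕ) - (i : ℕ)) / (2 * n)) <
      directionFunctional (Real.pi * ((i : ℕ) + (j : ℕ)) / (2 * n)) (circlePoint n k) := by
  rw [← sub_pos, directionFunctional_sub hn]
  have := mul_pos (sin_pos_of_lt hi) (neg_pos.2 (sin_neg_of_lt hj))
  linarith

theorem directionFunctional_lt_of_outside (hn : 0 < n) {i j k : Fin (2 * n)} (hij : i < j)
    (h : k < i ∨ j < k) :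
    directionFunctional (Real.pi * ((i : ℕ) + (j : ℕ)) / (2 * n)) (circlePoint n k) <
      Real.cos (Real.pi * ((j : ℕ) - (i : ℕ)) / (2 * n)) := by
  rw [← sub_neg, directionFunctional_sub hn]
  rcases h with h | h
  · have := mul_pos (neg_pos.2 (sin_neg_of_lt h)) (neg_pos.2 (sin_neg_of_lt (h.trans hij)))
    linarith
  · have := mul_pos (sin_pos_of_lt h) (sin_pos_of_lt (hij.trans h))
    linarith

theorem directionFunctional_eq_left (hn : 0 < n) (i j : Fin (2 * n)) :
    directionFunctional (Real.pi * ((i : ℕ) + (j : ℕ)) / (2 * n)) (circlePoint n i) =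
      Real.cos (Real.pi * ((j : ℕ) - (i : ℕ)) / (2 * n)) := by
  rw [← sub_eq_zero, directionFunctional_sub hn]
  simp

theorem directionFunctional_eq_right (hn : 0 < n) (i j : Fin (2 * n)) :
    directionFunctional (Real.pi * ((i : ℕ) + (j : ℕ)) / (2 * n)) (circlePoint n j) =
      Real.cos (Real.pi * ((j : ℕ) - (i : ℕ)) / (2 * n)) := by
  rw [← sub_eq_zero, directionFunctional_sub hn]
  simp

theorem disjoint_edgeSegment {i j k l : Fin (2 * n)} (hij : i < j)
    (h : (i < k ∧ k < j ∧ i < l ∧ l < j) ∨ ((k < i ∨ j < k) ∧ (l < i ∨ j < l))) :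
    Disjoint (edgeSegment n s(i, j)) (edgeSegment n s(k, l)) := by
  have hn : 0 < n := by have := i.2; omega
  rw [edgeSegment_mk, edgeSegment_mk]
  set f := directionFunctional (Real.pi * ((i : ℕ) + (j : ℕ)) / (2 * n)) with hf
  set c := Real.cos (Real.pi * ((j : ℕ) - (i : ℕ)) / (2 * n)) with hc
  have h1 : segment ℝ (circlePoint n i) (circlePoint n j) ⊆ f ⁻¹' {c} :=
    ((convex_singleton c).linear_preimage f).segment_subset
      (directionFunctional_eq_left hn i j) (directionFunctional_eq_right hn i j)
  rcases h with ⟨hk, hk', hl, hl'⟩ | ⟨hk, hl⟩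
  · have h2 : segment ℝ (circlePoint n k) (circlePoint n l) ⊆ f ⁻¹' (Set.Ioi c) :=
      ((convex_Ioi c).linear_preimage f).segment_subset
        (directionFunctional_lt_of_between hn hk hk') (directionFunctional_lt_of_between hn hl hl')
    exact (Disjoint.preimage f (by simp)).mono h1 h2
  · have h2 : segment ℝ (circlePoint n k) (circlePoint n l) ⊆ f ⁻¹' (Set.Iio c) :=
      ((convex_Iio c).linear_preimage f).segment_subset
        (directionFunctional_lt_of_outside hn hij hk) (directionFunctional_lt_of_outside hn hij hl)
    exact (Disjoint.preimage f (by simp)).mono h1 h2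

/-- Twice the signed area of a triangle. -/
def signedArea (p q r : ℂ) : ℝ := (q.re - p.re) * (r.im - p.im) - (q.im - p.im) * (r.re - p.re)

/-- With half the central angles `x` and `y`, the doubled area is `4 * sin x * sin y * sin (x + y)`.
-/
theorem signedArea_circlePoint_pos {i j k : Fin (2 * n)} (hij : i < j) (hjk : j < k) :
    0 < signedArea (circlePoint n i) (circlePoint n j) (circlePoint n k) := by
  have hn : (n : ℝ) ≠ 0 := by
    have := i.2
    exact_mod_cast (by omega : n ≠ 0)
  have hx := sin_pos_of_lt hij
  have hy := sin_pos_of_lt hjk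
  have hz := sin_pos_of_lt (hij.trans hjk)
  have key : ∀ a x y : ℝ, (Real.cos (a + 2 * x) - Real.cos a) *
      (Real.sin (a + 2 * x + 2 * y) - Real.sin a) - (Real.sin (a + 2 * x) - Real.sin a) *
      (Real.cos (a + 2 * x + 2 * y) - Real.cos a) =
      4 * (Real.sin x * Real.sin y * Real.sin (x + y)) := by
    intro a x y
    have e1 : ∀ u v : ℝ, Real.cos u * Real.sin v - Real.sin u * Real.cos v = Real.sin (v - u) := by
      intro u v
      rw [Real.sin_sub]
      ring
    have e2 := e1 (a + 2 * x) (a + 2 * x + 2 * y)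
    have e3 := e1 (a + 2 * x) a
    have e4 := e1 a (a + 2 * x + 2 * y)
    rw [show a + 2 * x + 2 * y - (a + 2 * x) = 2 * y by ring, Real.sin_two_mul] at e2
    rw [show a - (a + 2 * x) = -(2 * x) by ring, Real.sin_neg, Real.sin_two_mul] at e3
    rw [show a + 2 * x + 2 * y - a = 2 * (x + y) by ring, Real.sin_two_mul, Real.sin_add x y,
      Real.cos_add x y] at e4
    rw [Real.sin_add x y]
    have hx := Real.sin_sq_add_cos_sq x
    have hy := Real.sin_sq_add_cos_sq y
    linear_combination e2 - e3 - e4 - 2 * Real.sin y * Real.cos y * hx -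
      2 * Real.sin x * Real.cos x * hy
  have hk := key (Real.pi * (i : ℕ) / n) (Real.pi * ((j : ℕ) - (i : ℕ)) / (2 * n))
    (Real.pi * ((k : ℕ) - (j : ℕ)) / (2 * n))
  rw [show Real.pi * (i : ℕ) / n + 2 * (Real.pi * ((j : ℕ) - (i : ℕ)) / (2 * n)) =
      Real.pi * (j : ℕ) / n by field_simp; ring,
    show Real.pi * (j : ℕ) / n + 2 * (Real.pi * ((k : ℕ) - (j : ℕ)) / (2 * n)) =
      Real.pi * (k : ℕ) / n by field_simp; ring,
    show Real.pi * ((j : ℕ) - (i : ℕ)) / (2 * n) + Real.pi * ((k : ℕ) - (j : ℕ)) / (2 * n) =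
      Real.pi * ((k : ℕ) - (i : ℕ)) / (2 * n) by field_simp; ring] at hk
  rw [signedArea, circlePoint_re, circlePoint_re, circlePoint_re, circlePoint_im, circlePoint_im,
    circlePoint_im, hk]
  positivity

theorem not_disjoint_edgeSegment {i j k l : Fin (2 * n)} (hik : i < k) (hkj : k < j) (hjl : j < l) :
    ¬ Disjoint (edgeSegment n s(i, j)) (edgeSegment n s(k, l)) := by
  rw [edgeSegment_mk, edgeSegment_mk, Set.not_disjoint_iff]
  have hA := signedArea_circlePoint_pos hkj hjl
  have hB := signedArea_circlePoint_pos (hik.trans hkj) hjl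
  have hC := signedArea_circlePoint_pos hik (hkj.trans hjl)
  have hD := signedArea_circlePoint_pos hik hkj
  generalize circlePoint n i = p at *
  generalize circlePoint n k = q at *
  generalize circlePoint n j = r at *
  generalize circlePoint n l = t at *
  have hsum : signedArea q r t + signedArea p q t = signedArea p r t + signedArea p q r := by
    simp only [signedArea]
    ring
  -- The affine dependence of four points in the plane has triangle areas as coefficients.
  -- Normalized, its two sides express the intersection point of the diagonals.
  have hpt : signedArea q r t • p + signedArea p q t • r =
      signedArea p r t • q + signedArea p q r • t := by
    apply Complex.ext <;> simp [signedArea] <;> ring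
  generalize signedArea q r t = A at *
  generalize signedArea p r t = B at *
  generalize signedArea p q t = C at *
  generalize signedArea p q r = D at *
  have hAC : A + C ≠ 0 := by positivity
  refine ⟨(A / (A + C)) • p + (C / (A + C)) • r,
    ⟨A / (A + C), C / (A + C), by positivity, by positivity, by field_simp, rfl⟩,
    ⟨B / (A + C), D / (A + C), by positivity, by positivity, ?_, ?_⟩⟩
  · rw [← add_div, ← hsum, div_self hAC]
  · simp only [div_eq_inv_mul, mul_smul, ← smul_add]
    rw [hpt]

theorem zero_notMem_convexHull_of_pos {s : Set ℂ} {f : ℂ →ₗ[ℝ] ℝ} (h : ∀ z ∈ s, 0 < f z) :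
    (0 : ℂ) ∉ convexHull ℝ s := by
  intro h0
  have := convexHull_min (t := f ⁻¹' (Set.Ioi 0)) h ((convex_Ioi 0).linear_preimage f) h0
  simp at this

/-- A gap of more than half the circle leaves all points in an open half-plane opposite to the
middle of the gap. -/
theorem zero_notMem_convexHull_of_gap {s : Set (Fin (2 * n))} {x y : Fin (2 * n)}
    (hxy : (x : ℕ) + n < y) (h : ∀ k ∈ s, k ≤ x ∨ y ≤ k) :
    (0 : ℂ) ∉ convexHull ℝ (circlePoint n '' s) := by
  have hn : (0 : ℝ) < n := by
    have := y.2
    exact_mod_cast (by omega : 0 < n)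
  refine zero_notMem_convexHull_of_pos
    (f := directionFunctional (Real.pi * ((x : ℕ) + (y : ℕ)) / (2 * n) + Real.pi)) ?_
  rintro _ ⟨k, hk, rfl⟩
  rw [directionFunctional_circlePoint, ← sub_sub, Real.cos_sub_pi, neg_pos]
  have hx0 : (0 : ℝ) ≤ (x : ℕ) := by positivity
  have hk0 : (0 : ℝ) ≤ (k : ℕ) := by positivity
  have hxy' : ((x : ℕ) : ℝ) + n < (y : ℕ) := by exact_mod_cast hxy
  have hy : ((y : ℕ) : ℝ) < 2 * n := by exact_mod_cast y.2
  have hk2 : ((k : ℕ) : ℝ) < 2 * n := by exact_mod_cast k.2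
  have hπ := Real.pi_pos
  have hsub : Real.pi * (k : ℕ) / n - Real.pi * ((x : ℕ) + (y : ℕ)) / (2 * n) =
      Real.pi * (2 * (k : ℕ) - (x : ℕ) - (y : ℕ)) / (2 * n) := by
    field_simp
    ring
  rw [hsub]
  rcases h k hk with hkx | hyk
  · have hkx' : ((k : ℕ) : ℝ) ≤ (x : ℕ) := by exact_mod_cast hkx
    rw [← Real.cos_neg]
    apply Real.cos_neg_of_pi_div_two_lt_of_lt
    · rw [← neg_div, lt_div_iff₀ (by positivity)]
      nlinarith
    · rw [← neg_div, div_lt_iff₀ (by positivity)]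
      nlinarith
  · have hyk' : ((y : ℕ) : ℝ) ≤ (k : ℕ) := by exact_mod_cast hyk
    apply Real.cos_neg_of_pi_div_two_lt_of_lt
    · rw [lt_div_iff₀ (by positivity)]
      nlinarith
    · rw [div_lt_iff₀ (by positivity)]
      nlinarith

theorem zero_notMem_convexHull_of_arc {s : Set (Fin (2 * n))} {x y : Fin (2 * n)}
    (hxy : (y : ℕ) < x + n) (h : ∀ k ∈ s, x ≤ k ∧ k ≤ y) :
    (0 : ℂ) ∉ convexHull ℝ (circlePoint n '' s) := by
  have hn : (0 : ℝ) < n := by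
    have := y.2
    exact_mod_cast (by omega : 0 < n)
  refine zero_notMem_convexHull_of_pos
    (f := directionFunctional (Real.pi * ((x : ℕ) + (y : ℕ)) / (2 * n))) ?_
  rintro _ ⟨k, hk, rfl⟩
  rw [directionFunctional_circlePoint]
  have hxy' : ((y : ℕ) : ℝ) < (x : ℕ) + n := by exact_mod_cast hxy
  have hxk : ((x : ℕ) : ℝ) ≤ (k : ℕ) := by exact_mod_cast (h k hk).1
  have hky : ((k : ℕ) : ℝ) ≤ (y : ℕ) := by exact_mod_cast (h k hk).2
  have hπ := Real.pi_pos
  have hsub : Real.pi * (k : ℕ) / n - Real.pi * ((x : ℕ) + (y : ℕ)) / (2 * n) =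
      Real.pi * (2 * (k : ℕ) - (x : ℕ) - (y : ℕ)) / (2 * n) := by
    field_simp
    ring
  rw [hsub]
  apply Real.cos_pos_of_mem_Ioo
  constructor
  · rw [lt_div_iff₀ (by positivity)]
    nlinarith
  · rw [div_lt_iff₀ (by positivity)]
    nlinarith

theorem quadrilateral_eq (a b c d : Fin (2 * n)) :
    quadrilateral n a b c d = convexHull ℝ (circlePoint n '' {a, b, c, d}) := by
  rw [quadrilateral]
  simp only [Set.image_insert_eq, Set.image_singleton]

end CirclePoints

/-! ### Binary trees as non-crossing arc systems. -/

section TreeArcs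

open BinaryTree

/-- The arcs of the non-crossing matching encoded by a binary tree, on an interval of integers
starting at `s`: the root matches `s`, its left subtree encodes the arcs below the arc of the root,
its right subtree those to the right of it. -/
def treeArcs : ℕ → BinaryTree Unit → Finset (ℕ × ℕ)
  | _, .nil => ∅
  | s, .node _ l r => insert (s, s + 2 * l.numNodes + 1)
      (treeArcs (s + 1) l ∪ treeArcs (s + 2 * l.numNodes + 2) r)

/-- A set of ordered pairs that forms a non-crossing perfect matching of the integers in `[s, t)`. -/
structure IsNoncrossingArcs (s t : ℕ) (R : Finset (ℕ × ℕ)) : Prop where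
  bounds : ∀ p ∈ R, s ≤ p.1 ∧ p.1 < p.2 ∧ p.2 < t
  cover : ∀ k, s ≤ k → k < t → ∃ p ∈ R, p.1 = k ∨ p.2 = k
  unique : ∀ p ∈ R, ∀ q ∈ R, p.1 = q.1 ∨ p.1 = q.2 ∨ p.2 = q.2 → p = q
  noncrossing : ∀ p ∈ R, ∀ q ∈ R, ¬ (p.1 < q.1 ∧ q.1 < p.2 ∧ p.2 < q.2)

theorem mem_treeArcs_node {s : ℕ} {u : Unit} {l r : BinaryTree Unit} {p : ℕ × ℕ} :
    p ∈ treeArcs s (.node u l r) ↔ p = (s, s + 2 * l.numNodes + 1) ∨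
      p ∈ treeArcs (s + 1) l ∨ p ∈ treeArcs (s + 2 * l.numNodes + 2) r := by
  rw [treeArcs, Finset.mem_insert, Finset.mem_union]

theorem isNoncrossingArcs_treeArcs :
    ∀ (T : BinaryTree Unit) (s : ℕ), IsNoncrossingArcs s (s + 2 * T.numNodes) (treeArcs s T)
  | .nil, s => by
    constructor <;> simp [treeArcs]
  | .node u l r, s => by
    have hl := isNoncrossingArcs_treeArcs l (s + 1)
    have hr := isNoncrossingArcs_treeArcs r (s + 2 * l.numNodes + 2)
    refine ⟨?_, ?_, ?_, ?_⟩
    · intro p hp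
      simp only [numNodes]
      rcases mem_treeArcs_node.1 hp with rfl | hp | hp
      · simp only
        omega
      · have := hl.bounds p hp
        omega
      · have := hr.bounds p hp
        omega
    · intro k h1 h2
      simp only [numNodes] at h2
      rcases lt_trichotomy k (s + 2 * l.numNodes + 1) with h | h | h
      · rcases h1.eq_or_lt with h3 | h3
        · exact ⟨_, mem_treeArcs_node.2 (Or.inl rfl), Or.inl h3⟩
        · obtain ⟨p, hp, hpk⟩ := hl.cover k (by omega) (by omega)
          exact ⟨p, mem_treeArcs_node.2 (Or.inr (Or.inl hp)), hpk⟩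
      · exact ⟨_, mem_treeArcs_node.2 (Or.inl rfl), Or.inr h.symm⟩
      · obtain ⟨p, hp, hpk⟩ := hr.cover k (by omega) (by omega)
        exact ⟨p, mem_treeArcs_node.2 (Or.inr (Or.inr hp)), hpk⟩
    · intro p hp q hq h
      rcases mem_treeArcs_node.1 hp with rfl | hp | hp <;>
        rcases mem_treeArcs_node.1 hq with rfl | hq | hq
      · rfl
      · have := hl.bounds q hq
        simp only at h
        omega
      · have := hr.bounds q hq
        simp only at h
        omega
      · have := hl.bounds p hp
        simp only at h
        omega
      · exact hl.unique p hp q hq h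
      · have := hl.bounds p hp
        have := hr.bounds q hq
        omega
      · have := hr.bounds p hp
        simp only at h
        omega
      · have := hr.bounds p hp
        have := hl.bounds q hq
        omega
      · exact hr.unique p hp q hq h
    · intro p hp q hq h
      rcases mem_treeArcs_node.1 hp with rfl | hp | hp <;>
        rcases mem_treeArcs_node.1 hq with rfl | hq | hq
      · simp only at h
        omega
      · have := hl.bounds q hq
        simp only at h
        omega
      · have := hr.bounds q hq
        simp only at h
        omega
      · have := hl.bounds p hp
        simp only at h
        omega
      · exact hl.noncrossing p hp q hq h
      · have := hl.bounds p hp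
        have := hr.bounds q hq
        omega
      · have := hr.bounds p hp
        simp only at h
        omega
      · have := hr.bounds p hp
        have := hl.bounds q hq
        omega
      · exact hr.noncrossing p hp q hq h

/-- The partner of `s` determines the size of the left subtree; the ranges of the endpoints then
separate the arcs of the two subtrees. -/
theorem treeArcs_injective : ∀ (T T' : BinaryTree Unit) (s : ℕ),
    treeArcs s T = treeArcs s T' → T = T'
  | .nil, .nil, _, _ => rfl
  | .nil, .node _ _ _, _, h => absurd h.symm (Finset.insert_ne_empty _ _)
  | .node _ _ _, .nil, _, h => absurd h (Finset.insert_ne_empty _ _)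
  | .node u l r, .node u' l' r', s, h => by
    have hl := isNoncrossingArcs_treeArcs l (s + 1)
    have hr := isNoncrossingArcs_treeArcs r (s + 2 * l.numNodes + 2)
    have hl' := isNoncrossingArcs_treeArcs l' (s + 1)
    have hr' := isNoncrossingArcs_treeArcs r' (s + 2 * l'.numNodes + 2)
    have hsize : l.numNodes = l'.numNodes := by
      have h1 : (s, s + 2 * l.numNodes + 1) ∈ treeArcs s (.node u' l' r') := by
        rw [← h]
        exact mem_treeArcs_node.2 (Or.inl rfl)
      have h2 := (isNoncrossingArcs_treeArcs (.node u' l' r') s).unique _ h1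
        (s, s + 2 * l'.numNodes + 1) (mem_treeArcs_node.2 (Or.inl rfl)) (Or.inl rfl)
      have := congrArg Prod.snd h2
      simp only at this
      omega
    have hiff : ∀ p, p ∈ treeArcs s (.node u l r) ↔ p ∈ treeArcs s (.node u' l' r') := by
      intro p
      rw [h]
    simp only [mem_treeArcs_node, ← hsize] at hiff
    rw [← hsize] at hr'
    have e1 : treeArcs (s + 1) l = treeArcs (s + 1) l' := by
      ext p
      constructor <;> intro hp
      · rcases (hiff p).1 (Or.inr (Or.inl hp)) with rfl | hp' | hp'
        · have := hl.bounds _ hp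
          simp only at this
          omega
        · exact hp'
        · have := hl.bounds _ hp
          have := hr'.bounds _ hp'
          omega
      · rcases (hiff p).2 (Or.inr (Or.inl hp)) with rfl | hp' | hp'
        · have := hl'.bounds _ hp
          simp only at this
          omega
        · exact hp'
        · have := hl'.bounds _ hp
          have := hr.bounds _ hp'
          omega
    have e2 : treeArcs (s + 2 * l.numNodes + 2) r = treeArcs (s + 2 * l.numNodes + 2) r' := by
      ext p
      constructor <;> intro hp
      · rcases (hiff p).1 (Or.inr (Or.inr hp)) with rfl | hp' | hp'
        · have := hr.bounds _ hp
          simp only at this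
          omega
        · have := hl'.bounds _ hp'
          have := hr.bounds _ hp
          omega
        · exact hp'
      · rcases (hiff p).2 (Or.inr (Or.inr hp)) with rfl | hp' | hp'
        · have := hr'.bounds _ hp
          simp only at this
          omega
        · have := hl.bounds _ hp'
          have := hr'.bounds _ hp
          omega
        · exact hp'
    rw [treeArcs_injective l l' _ e1, treeArcs_injective r r' _ e2]

theorem IsNoncrossingArcs.exists_tree {s t : ℕ} {R : Finset (ℕ × ℕ)} (h : IsNoncrossingArcs s t R)
    (hst : s ≤ t) : ∃ T : BinaryTree Unit, t = s + 2 * T.numNodes ∧ R = treeArcs s T := by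
  induction hm : t - s using Nat.strong_induction_on generalizing s t R with
  | _ m ih =>
    rcases hst.eq_or_lt with rfl | hlt
    · refine ⟨.nil, by simp, Finset.eq_empty_of_forall_notMem fun p hp => ?_⟩
      have := h.bounds p hp
      omega
    · obtain ⟨⟨s', j⟩, hp, hps⟩ := h.cover s le_rfl hlt
      have hb := h.bounds _ hp
      simp only at hps hb
      obtain rfl : s' = s := by omega
      -- No arc crosses the arc `(s', j)` of the first point, so the others split into those below
      -- it and those to its right, which yield the two subtrees.
      have hnest : ∀ q ∈ R, q = (s', j) ∨ (s' < q.1 ∧ q.2 < j) ∨ j < q.1 := by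
        intro q hq
        have hqb := h.bounds q hq
        by_cases hqe : q = (s', j)
        · exact Or.inl hqe
        · have h1 : q.1 ≠ s' := fun e => hqe (h.unique q hq _ hp (Or.inl e))
          have h2 : q.1 ≠ j := fun e => hqe (h.unique q hq _ hp (Or.inr (Or.inl e)))
          have h4 : q.2 ≠ j := fun e => hqe (h.unique q hq _ hp (Or.inr (Or.inr e)))
          have h3 : ¬ (s' < q.1 ∧ q.1 < j ∧ j < q.2) := h.noncrossing _ hp q hq
          right
          omega
      obtain ⟨l, hl1, hl2⟩ := ih (j - (s' + 1)) (by omega) (s := s' + 1) (t := j)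
        (R := R.filter fun q => s' < q.1 ∧ q.2 < j) ⟨by
          intro q hq
          have := h.bounds q (Finset.mem_filter.1 hq).1
          have := (Finset.mem_filter.1 hq).2
          omega, by
          intro k hk1 hk2
          obtain ⟨q, hq, hqk⟩ := h.cover k (by omega) (by omega)
          refine ⟨q, Finset.mem_filter.2 ⟨hq, ?_⟩, hqk⟩
          have hqb := h.bounds q hq
          rcases hnest q hq with rfl | h' | h'
          · simp only at hqk
            omega
          · exact h'
          · omega, fun p hp q hq => h.unique p (Finset.mem_filter.1 hp).1 q
            (Finset.mem_filter.1 hq).1, fun p hp q hq => h.noncrossing p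
            (Finset.mem_filter.1 hp).1 q (Finset.mem_filter.1 hq).1⟩ (by omega) rfl
      obtain ⟨r, hr1, hr2⟩ := ih (t - (j + 1)) (by omega) (s := j + 1) (t := t)
        (R := R.filter fun q => j < q.1) ⟨by
          intro q hq
          have := h.bounds q (Finset.mem_filter.1 hq).1
          have := (Finset.mem_filter.1 hq).2
          omega, by
          intro k hk1 hk2
          obtain ⟨q, hq, hqk⟩ := h.cover k (by omega) (by omega)
          refine ⟨q, Finset.mem_filter.2 ⟨hq, ?_⟩, hqk⟩
          have hqb := h.bounds q hq
          rcases hnest q hq with rfl | h' | h'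
          · simp only at hqk
            omega
          · omega
          · exact h', fun p hp q hq => h.unique p (Finset.mem_filter.1 hp).1 q
            (Finset.mem_filter.1 hq).1, fun p hp q hq => h.noncrossing p
            (Finset.mem_filter.1 hp).1 q (Finset.mem_filter.1 hq).1⟩ (by omega) rfl
      refine ⟨.node () l r, by simp only [numNodes]; omega, ?_⟩
      ext q
      rw [mem_treeArcs_node, ← hl2, show s' + 2 * l.numNodes + 2 = j + 1 by omega, ← hr2,
        Finset.mem_filter, Finset.mem_filter, show s' + 2 * l.numNodes + 1 = j by omega]
      constructor
      · intro hq
        rcases hnest q hq with h' | h' | h'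
        · exact Or.inl h'
        · exact Or.inr (Or.inl ⟨hq, h'⟩)
        · exact Or.inr (Or.inr ⟨hq, h'⟩)
      · rintro (rfl | h' | h')
        · exact hp
        · exact h'.1
        · exact h'.1

theorem treeArcs_parity : ∀ (T : BinaryTree Unit) (s : ℕ), ∀ p ∈ treeArcs s T,
    (p.1 + p.2) % 2 = 1
  | .nil, _, p, hp => by simp [treeArcs] at hp
  | .node u l r, s, p, hp => by
    rcases mem_treeArcs_node.1 hp with rfl | hp | hp
    · simp only
      omega
    · exact treeArcs_parity l _ p hp
    · exact treeArcs_parity r _ p hp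

/-- The contribution of an arc to the invariant of centered flips on `2 * n` points. -/
def arcWeight (n : ℕ) (p : ℕ × ℕ) : ℤ :=
  (if p.1 % 2 = 0 then 1 else 0) + if p.1 + n < p.2 then (if p.1 % 2 = 0 then 1 else -1) else 0

/-- A left turn moves the starting point by 1 and a right turn by an even number, so the parity of a
left endpoint records the left turns. An arc has length `2 * l.numNodes + 1`, which exceeds `2 * h`
exactly if `h ≤ l.numNodes`. -/
theorem sum_arcWeight_treeArcs (h : ℕ) : ∀ (T : BinaryTree Unit) (s : ℕ),
    ∑ p ∈ treeArcs s T, arcWeight (2 * h) p = leftParityCount (decide (s % 2 = 0)) T +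
      (if s % 2 = 0 then 1 else -1) * signedHeavyCount h T
  | .nil, s => by simp [treeArcs, leftParityCount, signedHeavyCount]
  | .node u l r, s => by
    have hl := isNoncrossingArcs_treeArcs l (s + 1)
    have hr := isNoncrossingArcs_treeArcs r (s + 2 * l.numNodes + 2)
    have hmod : (s + 2 * l.numNodes + 2) % 2 = s % 2 := by omega
    rw [treeArcs, Finset.sum_insert, Finset.sum_union, sum_arcWeight_treeArcs h l,
      sum_arcWeight_treeArcs h r, leftParityCount, signedHeavyCount, arcWeight, hmod]
    · simp only
      rcases Nat.mod_two_eq_zero_or_one s with hs | hs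
      · rw [show (s + 1) % 2 = 1 by omega, hs]
        by_cases hh : h ≤ l.numNodes
        · rw [if_pos hh, if_pos (by omega : s + 2 * h < s + 2 * l.numNodes + 1)]
          simp
          ring
        · rw [if_neg hh, if_neg (by omega : ¬ s + 2 * h < s + 2 * l.numNodes + 1)]
          simp
          ring
      · rw [show (s + 1) % 2 = 0 by omega, hs]
        by_cases hh : h ≤ l.numNodes
        · rw [if_pos hh, if_pos (by omega : s + 2 * h < s + 2 * l.numNodes + 1)]
          simp
          ring
        · rw [if_neg hh, if_neg (by omega : ¬ s + 2 * h < s + 2 * l.numNodes + 1)]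
          simp
          ring
    · rw [Finset.disjoint_left]
      intro p hp hp'
      have := hl.bounds p hp
      have := hr.bounds p hp'
      omega
    · intro hp
      rcases Finset.mem_union.1 hp with hp | hp
      · have := hl.bounds _ hp
        simp only at this
        omega
      · have := hr.bounds _ hp
        simp only at this
        omega

end TreeArcs

/-! ### Geometric matchings as arc systems and trees. -/

section MatchingArcs

open BinaryTree

variable {n : ℕ}

open Classical in
/-- The edges of a graph on `Fin (2 * n)`, as ordered pairs of natural numbers. -/
noncomputable def matchingArcs (M : (⊤ : SimpleGraph (Fin (2 * n))).Subgraph) : Finset (ℕ × ℕ) :=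
  (Finset.univ.filter fun p : Fin (2 * n) × Fin (2 * n) => p.1 < p.2 ∧ M.Adj p.1 p.2).image
    fun p => ((p.1 : ℕ), (p.2 : ℕ))

theorem mem_matchingArcs {M : (⊤ : SimpleGraph (Fin (2 * n))).Subgraph} {p : ℕ × ℕ} :
    p ∈ matchingArcs M ↔ ∃ a b : Fin (2 * n), a < b ∧ M.Adj a b ∧ p = ((a : ℕ), (b : ℕ)) := by
  simp only [matchingArcs, Finset.mem_image, Finset.mem_filter, Finset.mem_univ, true_and,
    Prod.exists, and_assoc, eq_comm (a := p)]

theorem mk_mem_matchingArcs {M : (⊤ : SimpleGraph (Fin (2 * n))).Subgraph} {a b : Fin (2 * n)} :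
    ((a : ℕ), (b : ℕ)) ∈ matchingArcs M ↔ a < b ∧ M.Adj a b := by
  rw [mem_matchingArcs]
  constructor
  · rintro ⟨a', b', h, h', e⟩
    obtain ⟨e1, e2⟩ := Prod.mk.inj e
    rw [Fin.ext e1, Fin.ext e2]
    exact ⟨h, h'⟩
  · rintro ⟨h, h'⟩
    exact ⟨a, b, h, h', rfl⟩

theorem NCMatching.adj_unique (M : NCMatching n) {a b c : Fin (2 * n)} (h : M.1.Adj a b)
    (h' : M.1.Adj a c) : b = c :=
  (M.2.1.1 (M.2.1.2 a)).unique h h'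

theorem isNoncrossingArcs_matchingArcs (M : NCMatching n) :
    IsNoncrossingArcs 0 (2 * n) (matchingArcs M.1) := by
  refine ⟨?_, ?_, ?_, ?_⟩
  · intro p hp
    obtain ⟨a, b, hab, -, rfl⟩ := mem_matchingArcs.1 hp
    exact ⟨Nat.zero_le _, hab, b.2⟩
  · intro k _ hk
    obtain ⟨b, hb, -⟩ := M.2.1.1 (M.2.1.2 ⟨k, hk⟩)
    rcases lt_trichotomy (⟨k, hk⟩ : Fin (2 * n)) b with h | h | h
    · exact ⟨_, mk_mem_matchingArcs.2 ⟨h, hb⟩, Or.inl rfl⟩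
    · exact absurd h hb.ne
    · exact ⟨_, mk_mem_matchingArcs.2 ⟨h, hb.symm⟩, Or.inr rfl⟩
  · intro p hp q hq h
    obtain ⟨a, b, hab, hM, rfl⟩ := mem_matchingArcs.1 hp
    obtain ⟨c, d, hcd, hM', rfl⟩ := mem_matchingArcs.1 hq
    simp only [← Fin.ext_iff] at h
    rcases h with rfl | rfl | rfl
    · rw [M.adj_unique hM hM']
    · have := M.adj_unique hM hM'.symm
      subst this
      exact absurd hab (not_lt_of_gt hcd)
    · rw [M.adj_unique hM.symm hM'.symm]
  · intro p hp q hq h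
    obtain ⟨a, b, hab, hM, rfl⟩ := mem_matchingArcs.1 hp
    obtain ⟨c, d, hcd, hM', rfl⟩ := mem_matchingArcs.1 hq
    obtain ⟨h1, h2, h3⟩ : a < c ∧ c < b ∧ b < d := h
    refine not_disjoint_edgeSegment h1 h2 h3 (M.2.2 _ hM _ hM' fun e => ?_)
    rw [Sym2.eq_iff] at e
    rcases e with ⟨rfl, -⟩ | ⟨-, rfl⟩ <;> exact lt_irrefl _ (by assumption)

theorem matchingArcs_injective {M M' : NCMatching n} (h : matchingArcs M.1 = matchingArcs M'.1) :
    M = M' := by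
  refine Subtype.ext (SimpleGraph.Subgraph.ext ?_ ?_)
  · rw [M.2.1.2.verts_eq_univ, M'.2.1.2.verts_eq_univ]
  · ext a b
    have key : ∀ a b : Fin (2 * n), a < b → (M.1.Adj a b ↔ M'.1.Adj a b) := by
      intro a b hab
      have h1 := mk_mem_matchingArcs (M := M.1) (a := a) (b := b)
      rw [h, mk_mem_matchingArcs] at h1
      simpa [hab] using h1.symm
    rcases lt_trichotomy a b with hab | rfl | hab
    · exact key a b hab
    · exact ⟨fun h => absurd rfl h.ne, fun h => absurd rfl h.ne⟩
    · rw [M.1.adj_comm, M'.1.adj_comm]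
      exact key b a hab

theorem exists_matchingArcs_eq {R : Finset (ℕ × ℕ)} (hR : IsNoncrossingArcs 0 (2 * n) R) :
    ∃ M : NCMatching n, matchingArcs M.1 = R := by
  have hlt : ∀ {a b : ℕ}, (a, b) ∈ R → a < b := fun h => (hR.bounds _ h).2.1
  let M : (⊤ : SimpleGraph (Fin (2 * n))).Subgraph :=
    { verts := Set.univ
      Adj := fun a b => ((a : ℕ), (b : ℕ)) ∈ R ∨ ((b : ℕ), (a : ℕ)) ∈ R
      adj_sub := by
        rintro a b (h | h)
        · exact (Fin.ne_of_lt (hlt h))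
        · exact (Fin.ne_of_gt (hlt h))
      edge_vert := fun _ => Set.mem_univ _
      symm := ⟨fun _ _ h => h.symm⟩ }
  have hadj : ∀ a b, M.Adj a b ↔ ((a : ℕ), (b : ℕ)) ∈ R ∨ ((b : ℕ), (a : ℕ)) ∈ R :=
    fun a b => Iff.rfl
  have hedge : ∀ e ∈ M.edgeSet, ∃ a b : Fin (2 * n), ((a : ℕ), (b : ℕ)) ∈ R ∧ e = s(a, b) := by
    intro e
    induction e using Sym2.ind with
    | _ a b =>
      rintro (h | h)
      · exact ⟨a, b, h, rfl⟩
      · exact ⟨b, a, h, Sym2.eq_swap⟩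
  refine ⟨⟨M, ⟨?_, fun v => Set.mem_univ v⟩, ?_⟩, ?_⟩
  · intro v _
    obtain ⟨⟨i, j⟩, hp, h⟩ := hR.cover v (Nat.zero_le _) v.2
    have hb := hR.bounds _ hp
    simp only at hb h
    have huniq : ∀ w w' : Fin (2 * n), M.Adj v w → M.Adj v w' → w = w' := by
      intro w w' h1 h2
      rcases (hadj _ _).1 h1 with h1 | h1 <;> rcases (hadj _ _).1 h2 with h2 | h2
      · have := hR.unique _ h1 _ h2 (Or.inl rfl)
        exact Fin.ext (Prod.mk.inj this).2
      · have := hR.unique _ h1 _ h2 (Or.inr (Or.inl rfl))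
        have e := Prod.mk.inj this
        exact Fin.ext (e.2.trans e.1)
      · have := hR.unique _ h2 _ h1 (Or.inr (Or.inl rfl))
        have e := Prod.mk.inj this
        exact Fin.ext (e.2.trans e.1).symm
      · have := hR.unique _ h1 _ h2 (Or.inr (Or.inr rfl))
        exact Fin.ext (Prod.mk.inj this).1
    rcases h with rfl | rfl
    · exact ⟨⟨j, hb.2.2⟩, Or.inl hp, fun w hw => huniq _ _ hw (Or.inl hp)⟩
    · exact ⟨⟨i, by omega⟩, Or.inr hp, fun w hw => huniq _ _ hw (Or.inr hp)⟩
  · intro e he f hf hef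
    obtain ⟨a, b, hab, rfl⟩ := hedge e he
    obtain ⟨c, d, hcd, rfl⟩ := hedge f hf
    have hne : ((a : ℕ), (b : ℕ)) ≠ ((c : ℕ), (d : ℕ)) := by
      intro e
      obtain ⟨e1, e2⟩ := Prod.mk.inj e
      exact hef (by rw [Fin.ext e1, Fin.ext e2])
    have h1 : (a : ℕ) ≠ c := fun e => hne (hR.unique _ hab _ hcd (Or.inl e))
    have h2 : (a : ℕ) ≠ d := fun e => hne (hR.unique _ hab _ hcd (Or.inr (Or.inl e)))
    have h3 : (b : ℕ) ≠ d := fun e => hne (hR.unique _ hab _ hcd (Or.inr (Or.inr e)))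
    have h4 : (b : ℕ) ≠ c := fun e => hne (hR.unique _ hcd _ hab (Or.inr (Or.inl e.symm))).symm
    have h5 : ¬ ((a : ℕ) < c ∧ (c : ℕ) < b ∧ (b : ℕ) < d) := hR.noncrossing _ hab _ hcd
    have h6 : ¬ ((c : ℕ) < a ∧ (a : ℕ) < d ∧ (d : ℕ) < b) := hR.noncrossing _ hcd _ hab
    have hab' := hlt hab
    have hcd' := hlt hcd
    apply disjoint_edgeSegment hab'
    simp only [Fin.lt_def]
    omega
  · ext ⟨i, j⟩
    rw [mem_matchingArcs]
    constructor
    · rintro ⟨a, b, hab, h | h, e⟩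
      · rw [e]
        exact h
      · exact absurd (hlt h) (not_lt_of_gt hab)
    · intro h
      have hb := hR.bounds _ h
      simp only at hb
      exact ⟨⟨i, by omega⟩, ⟨j, hb.2.2⟩, hb.2.1, Or.inl h, rfl⟩

theorem NCMatching.exists_tree (M : NCMatching n) :
    ∃ T : BinaryTree Unit, T.numNodes = n ∧ matchingArcs M.1 = treeArcs 0 T := by
  obtain ⟨T, h1, h2⟩ := (isNoncrossingArcs_matchingArcs M).exists_tree (Nat.zero_le _)
  exact ⟨T, by omega, h2⟩

/-- The binary tree that encodes a non-crossing matching. -/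
noncomputable def NCMatching.toTree (M : NCMatching n) : BinaryTree Unit :=
  M.exists_tree.choose

theorem NCMatching.numNodes_toTree (M : NCMatching n) : M.toTree.numNodes = n :=
  M.exists_tree.choose_spec.1

theorem NCMatching.treeArcs_toTree (M : NCMatching n) : treeArcs 0 M.toTree = matchingArcs M.1 :=
  M.exists_tree.choose_spec.2.symm

theorem NCMatching.toTree_injective : Function.Injective (NCMatching.toTree (n := n)) := by
  intro M M' h
  apply matchingArcs_injective
  rw [← M.treeArcs_toTree, h, M'.treeArcs_toTree]

theorem NCMatching.exists_toTree_eq {T : BinaryTree Unit} (hT : T.numNodes = n) :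
    ∃ M : NCMatching n, M.toTree = T := by
  subst hT
  have := isNoncrossingArcs_treeArcs T 0
  rw [zero_add] at this
  obtain ⟨M, hM⟩ := exists_matchingArcs_eq this
  exact ⟨M, treeArcs_injective _ _ 0 (by rw [M.treeArcs_toTree, hM])⟩

/-- Non-crossing matchings of `2 * n` points correspond to binary trees with `n` nodes. -/
noncomputable def ncMatchingEquivTree (n : ℕ) : NCMatching n ≃ treesOfNumNodesEq n :=
  Equiv.ofBijective (fun M => ⟨M.toTree, mem_treesOfNumNodesEq.2 M.numNodes_toTree⟩)
    ⟨fun _ _ h => NCMatching.toTree_injective (congrArg Subtype.val h), fun T => by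
      obtain ⟨M, hM⟩ := NCMatching.exists_toTree_eq (mem_treesOfNumNodesEq.1 T.2)
      exact ⟨M, Subtype.ext hM⟩⟩

theorem finite_ncMatching (n : ℕ) : Finite (NCMatching n) :=
  Finite.of_equiv _ (ncMatchingEquivTree n).symm

theorem card_ncMatching (n : ℕ) : Nat.card (NCMatching n) = catalan n := by
  rw [Nat.card_congr (ncMatchingEquivTree n), ← treesOfNumNodesEq_card_eq_catalan,
    Nat.card_eq_fintype_card, Fintype.card_coe]

/-- The invariant of centered flips. -/
noncomputable def NCMatching.balance (M : NCMatching n) : ℤ :=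
  ∑ p ∈ matchingArcs M.1, arcWeight n p

theorem NCMatching.balance_eq {h : ℕ} (M : NCMatching (2 * h)) :
    M.balance = leftParityCount true M.toTree + signedHeavyCount h M.toTree := by
  rw [NCMatching.balance, ← M.treeArcs_toTree, sum_arcWeight_treeArcs]
  simp

theorem ncard_balance_le {h : ℕ} (hh : 1 ≤ h) (c : ℤ) :
    ({M : NCMatching (2 * h) | M.balance = c}.ncard : ℚ) ≤ narayana 1 (2 * h) h := by
  refine le_trans ?_ (card_filter_balance_le hh c)
  rw [Nat.cast_le, ← Set.ncard_image_of_injective _ NCMatching.toTree_injective,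
    ← Set.ncard_coe_finset]
  refine Set.ncard_le_ncard ?_ (Finset.finite_toSet _)
  rintro _ ⟨M, hM, rfl⟩
  rw [Finset.mem_coe, Finset.mem_filter, mem_treesOfNumNodesEq, ← M.balance_eq]
  exact ⟨M.numNodes_toTree, hM⟩

end MatchingArcs

/-! ### Invariance of the balance under centered flips. -/

section FlipInvariance

variable {n : ℕ}

/-- The pair of natural numbers formed by two points, in increasing order. -/
def arcOf (u v : Fin (2 * n)) : ℕ × ℕ := (min (u : ℕ) v, max (u : ℕ) v)

theorem arcOf_comm (u v : Fin (2 * n)) : arcOf u v = arcOf v u := by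
  rw [arcOf, arcOf, min_comm, max_comm]

theorem arcOf_of_lt {u v : Fin (2 * n)} (h : u < v) : arcOf u v = ((u : ℕ), (v : ℕ)) := by
  have : (u : ℕ) < v := h
  rw [arcOf, min_eq_left this.le, max_eq_right this.le]

theorem arcOf_mem_matchingArcs {M : (⊤ : SimpleGraph (Fin (2 * n))).Subgraph} {u v : Fin (2 * n)}
    (h : M.Adj u v) : arcOf u v ∈ matchingArcs M := by
  rcases lt_or_gt_of_ne h.ne with h' | h'
  · rw [arcOf_of_lt h', mk_mem_matchingArcs]
    exact ⟨h', h⟩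
  · rw [arcOf_comm, arcOf_of_lt h', mk_mem_matchingArcs]
    exact ⟨h', h.symm⟩

theorem arcOf_eq_iff {a b c d : Fin (2 * n)} : arcOf a b = arcOf c d ↔ s(a, b) = s(c, d) := by
  rw [Sym2.eq_iff, arcOf, arcOf, Prod.mk.injEq]
  simp only [Fin.ext_iff]
  omega

theorem matchingArcs_sdiff {M M' : NCMatching n} {a b c d : Fin (2 * n)}
    (h : M.1.edgeSet \ M'.1.edgeSet = {s(a, b), s(c, d)}) :
    matchingArcs M.1 \ matchingArcs M'.1 = {arcOf a b, arcOf c d} := by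
  ext p
  rw [Finset.mem_sdiff, Finset.mem_insert, Finset.mem_singleton]
  constructor
  · rintro ⟨h1, h2⟩
    obtain ⟨u, v, huv, hM, rfl⟩ := mem_matchingArcs.1 h1
    have h3 : s(u, v) ∈ M.1.edgeSet \ M'.1.edgeSet :=
      ⟨hM, fun hM' => h2 (mk_mem_matchingArcs.2 ⟨huv, hM'⟩)⟩
    rw [h] at h3
    rw [← arcOf_of_lt huv, arcOf_eq_iff, arcOf_eq_iff]
    exact h3
  · have key : ∀ u v, s(u, v) ∈ M.1.edgeSet \ M'.1.edgeSet →
        arcOf u v ∈ matchingArcs M.1 ∧ arcOf u v ∉ matchingArcs M'.1 := by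
      rintro u v ⟨hM, hM'⟩
      refine ⟨arcOf_mem_matchingArcs hM, fun hmem => hM' ?_⟩
      obtain ⟨x, y, hxy, hadj, e⟩ := mem_matchingArcs.1 hmem
      rw [← arcOf_of_lt hxy, arcOf_eq_iff] at e
      rw [e]
      exact hadj
    rw [h] at key
    rintro (rfl | rfl)
    · exact key _ _ (Or.inl rfl)
    · exact key _ _ (Or.inr rfl)

theorem arcOf_noncrossing (M : NCMatching n) {a b c d : Fin (2 * n)} (h : M.1.Adj a b)
    (h' : M.1.Adj c d) : ¬ ((arcOf a b).1 < (arcOf c d).1 ∧ (arcOf c d).1 < (arcOf a b).2 ∧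
      (arcOf a b).2 < (arcOf c d).2) :=
  (isNoncrossingArcs_matchingArcs M).noncrossing _ (arcOf_mem_matchingArcs h) _
    (arcOf_mem_matchingArcs h')

theorem NCMatching.adj_parity (M : NCMatching n) {a b : Fin (2 * n)} (h : M.1.Adj a b) :
    ((a : ℕ) + b) % 2 = 1 := by
  have h1 := arcOf_mem_matchingArcs h
  rw [← M.treeArcs_toTree] at h1
  have := treeArcs_parity _ _ _ h1
  simp only [arcOf] at this
  omega

/-- If `x` is even, both sums are 2: the extra 1 of the long arc `xw` makes up for `yz`, which
starts at an odd point. If `x` is odd, both are 0: the 1 of `yz` cancels against the -1 of `xw`. -/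
theorem arcWeight_sorted {x y z w : Fin (2 * n)} (hn : Even n) (hxy : x < y) (hyz : y < z)
    (hzw : z < w) (p1 : ((x : ℕ) + y) % 2 = 1) (p2 : ((y : ℕ) + z) % 2 = 1)
    (p3 : ((z : ℕ) + w) % 2 = 1)
    (h0 : (0 : ℂ) ∈ convexHull ℝ (circlePoint n '' {x, y, z, w})) :
    arcWeight n (arcOf x y) + arcWeight n (arcOf z w) =
      arcWeight n (arcOf y z) + arcWeight n (arcOf w x) := by
  have g1 : ¬ ((x : ℕ) + n < y) := fun hg => zero_notMem_convexHull_of_gap hg (by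
    rintro k (rfl | rfl | rfl | rfl) <;> simp only [Fin.le_def, Fin.lt_def] at * <;> omega) h0
  have g2 : ¬ ((y : ℕ) + n < z) := fun hg => zero_notMem_convexHull_of_gap hg (by
    rintro k (rfl | rfl | rfl | rfl) <;> simp only [Fin.le_def, Fin.lt_def] at * <;> omega) h0
  have g3 : ¬ ((z : ℕ) + n < w) := fun hg => zero_notMem_convexHull_of_gap hg (by
    rintro k (rfl | rfl | rfl | rfl) <;> simp only [Fin.le_def, Fin.lt_def] at * <;> omega) h0
  have g4 : ¬ ((w : ℕ) < x + n) := fun hg => zero_notMem_convexHull_of_arc hg (by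
    rintro k (rfl | rfl | rfl | rfl) <;> simp only [Fin.le_def, Fin.lt_def] at * <;> omega) h0
  obtain ⟨m, hm⟩ := hn
  rw [arcOf_comm w x, arcOf_of_lt hxy, arcOf_of_lt hyz, arcOf_of_lt hzw,
    arcOf_of_lt (hxy.trans (hyz.trans hzw))]
  simp only [arcWeight]
  -- `g4` gives only `x + n ≤ w`; the inequality is strict because `w - x` is odd and `n` is even.
  rw [if_neg g1, if_neg g2, if_neg g3, if_pos (show (x : ℕ) + n < w by omega)]
  rcases Nat.mod_two_eq_zero_or_one x with hx | hx
  · rw [if_pos hx, if_pos (show (z : ℕ) % 2 = 0 by omega),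
      if_neg (show ¬ (y : ℕ) % 2 = 0 by omega), if_pos hx]
    norm_num
  · rw [if_neg (by omega), if_neg (show ¬ (z : ℕ) % 2 = 0 by omega),
      if_pos (show (y : ℕ) % 2 = 0 by omega), if_neg (by omega)]
    norm_num

/-- Four points on a circle have one crossing pairing, the diagonals. As neither pairing here
crosses, `ac` and `bd` are the diagonals, which leaves four rotations of the cyclic order and their
reversals. -/
theorem cyclic_order_of_noncrossing {a b c d : Fin (2 * n)} (hab : a ≠ b) (hcd : c ≠ d)
    (hbc : b ≠ c) (hda : d ≠ a) (hac : a ≠ c) (hbd : b ≠ d)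
    (c1 : ¬ ((arcOf a b).1 < (arcOf c d).1 ∧ (arcOf c d).1 < (arcOf a b).2 ∧
      (arcOf a b).2 < (arcOf c d).2))
    (c2 : ¬ ((arcOf c d).1 < (arcOf a b).1 ∧ (arcOf a b).1 < (arcOf c d).2 ∧
      (arcOf c d).2 < (arcOf a b).2))
    (c3 : ¬ ((arcOf b c).1 < (arcOf d a).1 ∧ (arcOf d a).1 < (arcOf b c).2 ∧
      (arcOf b c).2 < (arcOf d a).2))
    (c4 : ¬ ((arcOf d a).1 < (arcOf b c).1 ∧ (arcOf b c).1 < (arcOf d a).2 ∧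
      (arcOf d a).2 < (arcOf b c).2)) :
    (a < b ∧ b < c ∧ c < d) ∨ (b < c ∧ c < d ∧ d < a) ∨ (c < d ∧ d < a ∧ a < b) ∨
      (d < a ∧ a < b ∧ b < c) ∨ (d < c ∧ c < b ∧ b < a) ∨ (c < b ∧ b < a ∧ a < d) ∨
      (b < a ∧ a < d ∧ d < c) ∨ (a < d ∧ d < c ∧ c < b) := by
  have key : ∀ u v : Fin (2 * n), u ≠ v → (arcOf u v = ((u : ℕ), (v : ℕ)) ∧ (u : ℕ) < v) ∨
      (arcOf u v = ((v : ℕ), (u : ℕ)) ∧ (v : ℕ) < u) := by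
    intro u v huv
    rcases lt_or_gt_of_ne huv with h | h
    · exact Or.inl ⟨arcOf_of_lt h, h⟩
    · exact Or.inr ⟨(arcOf_comm u v).trans (arcOf_of_lt h), h⟩
  rw [Ne, Fin.ext_iff] at hac hbd
  simp only [Fin.lt_def]
  rcases key a b hab with ⟨e1, h1⟩ | ⟨e1, h1⟩ <;> rcases key c d hcd with ⟨e2, h2⟩ | ⟨e2, h2⟩ <;>
    rcases key b c hbc with ⟨e3, h3⟩ | ⟨e3, h3⟩ <;>
    rcases key d a hda with ⟨e4, h4⟩ | ⟨e4, h4⟩ <;>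
    rw [e1, e2] at c1 c2 <;> rw [e3, e4] at c3 c4 <;> simp only at c1 c2 c3 c4 <;> omega

theorem arcWeight_flip (hn : Even n) {M M' : NCMatching n} {a b c d : Fin (2 * n)}
    (hab : M.1.Adj a b) (hcd : M.1.Adj c d) (hbc : M'.1.Adj b c) (hda : M'.1.Adj d a)
    (hac : a ≠ c) (hbd : b ≠ d) (h0 : (0 : ℂ) ∈ quadrilateral n a b c d) :
    arcWeight n (arcOf a b) + arcWeight n (arcOf c d) =
      arcWeight n (arcOf b c) + arcWeight n (arcOf d a) := by
  have n1 := hab.ne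
  have n2 := hcd.ne
  have n3 := hbc.ne
  have n4 := hda.ne
  have c1 := arcOf_noncrossing M hab hcd
  have c2 := arcOf_noncrossing M hcd hab
  have c3 := arcOf_noncrossing M' hbc hda
  have c4 := arcOf_noncrossing M' hda hbc
  have p1 := M.adj_parity hab
  have p2 := M.adj_parity hcd
  have p3 := M'.adj_parity hbc
  have p4 := M'.adj_parity hda
  rw [quadrilateral_eq] at h0
  have horder := cyclic_order_of_noncrossing n1 n2 n3 n4 hac hbd c1 c2 c3 c4
  clear c1 c2 c3 c4
  have hset : ∀ s : Set (Fin (2 * n)), s = {a, b, c, d} →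
      (0 : ℂ) ∈ convexHull ℝ (circlePoint n '' s) := by
    rintro s rfl
    exact h0
  rcases horder with ⟨h1, h2, h3⟩ | ⟨h1, h2, h3⟩ | ⟨h1, h2, h3⟩ | ⟨h1, h2, h3⟩ | ⟨h1, h2, h3⟩ |
    ⟨h1, h2, h3⟩ | ⟨h1, h2, h3⟩ | ⟨h1, h2, h3⟩
  · exact arcWeight_sorted hn h1 h2 h3 (by omega) (by omega) (by omega) h0
  · have := arcWeight_sorted hn h1 h2 h3 (by omega) (by omega) (by omega)
      (hset _ (by ext k; simp only [Set.mem_insert_iff, Set.mem_singleton_iff]; tauto))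
    linarith
  · have := arcWeight_sorted hn h1 h2 h3 (by omega) (by omega) (by omega)
      (hset _ (by ext k; simp only [Set.mem_insert_iff, Set.mem_singleton_iff]; tauto))
    linarith
  · have := arcWeight_sorted hn h1 h2 h3 (by omega) (by omega) (by omega)
      (hset _ (by ext k; simp only [Set.mem_insert_iff, Set.mem_singleton_iff]; tauto))
    linarith
  · have := arcWeight_sorted hn h1 h2 h3 (by omega) (by omega) (by omega)
      (hset _ (by ext k; simp only [Set.mem_insert_iff, Set.mem_singleton_iff]; tauto))
    rw [arcOf_comm a b, arcOf_comm c d, arcOf_comm b c, arcOf_comm d a]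
    linarith
  · have := arcWeight_sorted hn h1 h2 h3 (by omega) (by omega) (by omega)
      (hset _ (by ext k; simp only [Set.mem_insert_iff, Set.mem_singleton_iff]; tauto))
    rw [arcOf_comm a b, arcOf_comm c d, arcOf_comm b c, arcOf_comm d a]
    linarith
  · have := arcWeight_sorted hn h1 h2 h3 (by omega) (by omega) (by omega)
      (hset _ (by ext k; simp only [Set.mem_insert_iff, Set.mem_singleton_iff]; tauto))
    rw [arcOf_comm a b, arcOf_comm c d, arcOf_comm b c, arcOf_comm d a]
    linarith
  · have := arcWeight_sorted hn h1 h2 h3 (by omega) (by omega) (by omega)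
      (hset _ (by ext k; simp only [Set.mem_insert_iff, Set.mem_singleton_iff]; tauto))
    rw [arcOf_comm a b, arcOf_comm c d, arcOf_comm b c, arcOf_comm d a]
    linarith

theorem NCMatching.balance_eq_of_adj (hn : Even n) {M M' : NCMatching n}
    (h : (centeredFlipGraph n).Adj M M') : M.balance = M'.balance := by
  obtain ⟨a, b, c, d, ⟨h1, h2, -⟩, h0⟩ := h
  have hab : s(a, b) ∈ M.1.edgeSet \ M'.1.edgeSet := by
    rw [h1]
    exact Or.inl rfl
  have hcd : s(c, d) ∈ M.1.edgeSet \ M'.1.edgeSet := by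
    rw [h1]
    exact Or.inr rfl
  have hbc : s(b, c) ∈ M'.1.edgeSet \ M.1.edgeSet := by
    rw [h2]
    exact Or.inl rfl
  have hda : s(d, a) ∈ M'.1.edgeSet \ M.1.edgeSet := by
    rw [h2]
    exact Or.inr rfl
  have hac : a ≠ c := by
    rintro rfl
    exact hab.2 (by rw [Sym2.eq_swap]; exact hbc.1)
  have hbd : b ≠ d := by
    rintro rfl
    exact hab.2 (by rw [Sym2.eq_swap]; exact hda.1)
  have key : arcWeight n (arcOf a b) + arcWeight n (arcOf c d) =
      arcWeight n (arcOf b c) + arcWeight n (arcOf d a) :=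
    arcWeight_flip hn hab.1 hcd.1 hbc.1 hda.1 hac hbd h0
  have hne1 : arcOf a b ≠ arcOf c d := by
    rw [Ne, arcOf_eq_iff, Sym2.eq_iff]
    rintro (⟨e, -⟩ | ⟨e, -⟩)
    · exact hac e
    · exact (SimpleGraph.Subgraph.Adj.ne (H := M'.1) hda.1) e.symm
  have hne2 : arcOf b c ≠ arcOf d a := by
    rw [Ne, arcOf_eq_iff, Sym2.eq_iff]
    rintro (⟨e, -⟩ | ⟨-, e⟩)
    · exact hbd e
    · exact (SimpleGraph.Subgraph.Adj.ne (H := M.1) hcd.1) e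
  have hdiff := Finset.sum_sdiff_sub_sum_sdiff (s₁ := matchingArcs M'.1) (s₂ := matchingArcs M.1)
    (f := arcWeight n)
  rw [matchingArcs_sdiff h1, matchingArcs_sdiff h2, Finset.sum_pair hne1,
    Finset.sum_pair hne2] at hdiff
  rw [NCMatching.balance, NCMatching.balance]
  linarith

theorem NCMatching.balance_eq_of_reachable (hn : Even n) {M M' : NCMatching n}
    (h : (centeredFlipGraph n).Reachable M M') : M.balance = M'.balance := by
  obtain ⟨p⟩ := h
  induction p with
  | nil => rfl
  | cons hadj _ ih => exact (NCMatching.balance_eq_of_adj hn hadj).trans ih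

theorem ncard_supp_connectedComponent_le {h : ℕ} (hh : 1 ≤ h)
    (C : (centeredFlipGraph (2 * h)).ConnectedComponent) :
    (C.supp.ncard : ℚ) ≤ narayana 1 (2 * h) h := by
  have := finite_ncMatching (2 * h)
  obtain ⟨M, rfl⟩ := C.exists_rep
  refine le_trans ?_ (ncard_balance_le hh M.balance)
  rw [Nat.cast_le]
  refine Set.ncard_le_ncard (fun M' hM' => ?_) (Set.toFinite _)
  exact NCMatching.balance_eq_of_reachable (even_two_mul h)
    (SimpleGraph.ConnectedComponent.exact hM')

end FlipInvariance

/-! ### Asymptotics of the bound by Stirling's formula. -/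

section Asymptotics

theorem narayana_div_catalan (j : ℕ) :
    (narayana 1 (2 * (j + 1)) (j + 1) : ℝ) / catalan (2 * (j + 1)) =
      (j.centralBinom * (j + 2).centralBinom : ℝ) / (2 * (j + 1)).centralBinom := by
  have h1 : ((2 * (j + 1) + 1 : ℕ) : ℝ) * catalan (2 * (j + 1)) = (2 * (j + 1)).centralBinom := by
    exact_mod_cast succ_mul_catalan_eq_centralBinom (2 * (j + 1))
  rw [← h1, narayana_one_two_mul, Nat.centralBinom, Nat.centralBinom,
    show 2 * (j + 2) = 2 * j + 4 by ring]
  push_cast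
  have h2 : (2 * (j : ℝ) + 3) ≠ 0 := by positivity
  have h3 : (2 * ((j : ℝ) + 1) + 1) ≠ 0 := by positivity
  -- With a zero denominator both quotients are 0 by convention, so positivity of the Catalan number
  -- is not needed.
  rcases eq_or_ne (catalan (2 * (j + 1)) : ℝ) 0 with h | h
  · simp [h]
  · field_simp
    ring

theorem centralBinom_isEquivalent :
    (fun n : ℕ => (n.centralBinom : ℝ)) ~[atTop] fun n => 4 ^ n / Real.sqrt (Real.pi * n) := by
  have h1 := Stirling.factorial_isEquivalent_stirling
  have h2 := h1.comp_tendsto (tendsto_id.const_mul_atTop' (two_pos (α := ℕ)))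
  refine ((h2.div (h1.mul h1)).congr_left (Eventually.of_forall fun n => ?_)).congr_right ?_
  · have h3 : ((2 * n).factorial : ℝ) = n.centralBinom * n.factorial * n.factorial := by
      have := Nat.choose_mul_factorial_mul_factorial (show n ≤ 2 * n by omega)
      rw [show 2 * n - n = n by omega] at this
      rw [← this, Nat.centralBinom]
      push_cast
      ring
    have h4 : (n.factorial : ℝ) ≠ 0 := by positivity
    simp only [Function.comp, id, Pi.div_apply, Pi.mul_apply, h3]
    field_simp
  · filter_upwards [eventually_gt_atTop 0] with n hn
    have hn' : (0 : ℝ) < n := by exact_mod_cast hn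
    have hπ := Real.pi_pos
    have hs : Real.sqrt (2 * ((2 * n : ℕ) : ℝ) * Real.pi) = 2 * Real.sqrt (Real.pi * n) := by
      rw [show 2 * ((2 * n : ℕ) : ℝ) * Real.pi = 2 ^ 2 * (Real.pi * n) by push_cast; ring,
        Real.sqrt_mul (by positivity), Real.sqrt_sq (by positivity)]
    have hs2 : Real.sqrt (2 * n * Real.pi) * Real.sqrt (2 * n * Real.pi) =
        2 * (Real.sqrt (Real.pi * n) * Real.sqrt (Real.pi * n)) := by
      rw [Real.mul_self_sqrt (by positivity), Real.mul_self_sqrt (by positivity)]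
      ring
    have hs3 : Real.sqrt (Real.pi * n) ≠ 0 := by positivity
    have he : Real.exp 1 ≠ 0 := Real.exp_ne_zero _
    simp only [Function.comp, id, Pi.div_apply, Pi.mul_apply, hs]
    rw [mul_mul_mul_comm, hs2]
    push_cast
    rw [show (2 * (n : ℝ) / Real.exp 1) ^ (2 * n) =
      4 ^ n * ((n / Real.exp 1) ^ n * (n / Real.exp 1) ^ n) by
        rw [pow_mul, ← mul_pow, ← mul_pow]; congr 1; ring]
    have h5 : ((n : ℝ) / Real.exp 1) ^ n ≠ 0 := by positivity
    field_simp

theorem centralBinom_ratio_isEquivalent :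
    (fun j : ℕ => (j.centralBinom * (j + 2).centralBinom : ℝ) / (2 * (j + 1)).centralBinom)
      ~[atTop] fun j => 2 / Real.sqrt (Real.pi * (2 * (j + 1) : ℕ)) := by
  have h := centralBinom_isEquivalent
  have h2 := h.comp_tendsto (tendsto_add_atTop_nat 2)
  have h3 := h.comp_tendsto
    ((tendsto_id.const_mul_atTop' (two_pos (α := ℕ))).comp (tendsto_add_atTop_nat 1))
  refine IsEquivalent.trans ((h.mul h2).div h3) ?_
  apply isEquivalent_of_tendsto_one
  -- For `j > 0` this is the exact quotient of the two sides: the powers of 4 cancel and `j * (j +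
  -- 2) = (j + 1) ^ 2 - 1`.
  have hlim : Tendsto (fun j : ℕ => (Real.sqrt (1 - (((j + 1 : ℕ) : ℝ)⁻¹) ^ 2))⁻¹)
      atTop (nhds 1) := by
    have h1 : Tendsto (fun j : ℕ => (((j + 1 : ℕ) : ℝ)⁻¹)) atTop (nhds 0) :=
      tendsto_inv_atTop_nhds_zero_nat.comp (tendsto_add_atTop_nat 1)
    have h2 := ((h1.pow 2).const_sub 1).sqrt.inv₀ (by norm_num)
    simpa using h2
  refine hlim.congr' ?_
  filter_upwards [eventually_gt_atTop 0] with j hj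
  have hj' : (0 : ℝ) < j := by exact_mod_cast hj
  have hπ := Real.pi_pos
  have e1 : Real.sqrt (Real.pi * j) * Real.sqrt (Real.pi * ((j + 2 : ℕ) : ℝ)) =
      Real.pi * (j + 1) * Real.sqrt (1 - (((j + 1 : ℕ) : ℝ)⁻¹) ^ 2) := by
    rw [← Real.sqrt_mul (by positivity), ← Real.sqrt_sq (show 0 ≤ Real.pi * ((j : ℝ) + 1) by
      positivity), ← Real.sqrt_mul (by positivity)]
    congr 1
    push_cast
    field_simp
    ring
  have e2 : Real.sqrt (Real.pi * ((2 * (j + 1) : ℕ) : ℝ)) *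
      Real.sqrt (Real.pi * ((2 * (j + 1) : ℕ) : ℝ)) = 2 * (Real.pi * (j + 1)) := by
    rw [Real.mul_self_sqrt (by positivity)]
    push_cast
    ring
  have e3 : Real.sqrt (Real.pi * j) ≠ 0 := by positivity
  have e4 : Real.sqrt (Real.pi * ((j + 2 : ℕ) : ℝ)) ≠ 0 := by positivity
  have e5 : Real.sqrt (Real.pi * ((2 * (j + 1) : ℕ) : ℝ)) ≠ 0 := by positivity
  have e6 : Real.sqrt (1 - (((j + 1 : ℕ) : ℝ)⁻¹) ^ 2) ≠ 0 := by
    intro h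
    rw [h, mul_zero] at e1
    exact mul_ne_zero e3 e4 e1
  have e7 : (4 : ℝ) ^ (2 * (j + 1)) = 4 ^ j * 4 ^ (j + 2) := by
    rw [← pow_add]
    congr 1
    ring
  simp only [Function.comp, id, Pi.div_apply, Pi.mul_apply]
  rw [e7, div_mul_div_comm, e1, div_div_div_cancel_left', div_div_eq_mul_div,
    div_mul_eq_mul_div, e2]
  · field_simp
  · positivity

theorem narayana_div_catalan_isEquivalent :
    (fun n : ℕ => (narayana 1 n (n / 2) : ℝ) / (catalan n : ℝ))
      ~[atTop ⊓ 𝓟 {n : ℕ | Even n}] (fun n : ℕ => 2 / Real.sqrt (Real.pi * (n : ℝ))) := by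
  -- Every positive even number is `2 * (j + 1)` for some `j`, so the limit may be taken along `j`.
  have hle : atTop ⊓ 𝓟 {n : ℕ | Even n} ≤ map (fun j : ℕ => 2 * (j + 1)) atTop := by
    intro s hs
    rw [mem_map, mem_atTop_sets] at hs
    obtain ⟨N, hN⟩ := hs
    rw [mem_inf_principal]
    filter_upwards [eventually_ge_atTop (2 * (N + 1))] with n hn hev
    obtain ⟨m, rfl⟩ := hev
    have := hN (m - 1) (by omega)
    rw [Set.mem_preimage] at this
    rwa [show 2 * (m - 1 + 1) = m + m by omega] at this
  refine IsEquivalent.mono ?_ hle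
  rw [IsEquivalent, isLittleO_map]
  refine centralBinom_ratio_isEquivalent.congr_left (Eventually.of_forall fun j => ?_)
  simp only
  rw [show 2 * (j + 1) / 2 = j + 1 by omega, narayana_div_catalan]

end Asymptotics

theorem corollary5p10 :
    (∀ n : ℕ, 2 ≤ n → Even n →
      (∀ C : (centeredFlipGraph n).ConnectedComponent,
        C.supp.Finite ∧ (C.supp.ncard : ℚ) ≤ narayana 1 n (n / 2)) ∧
      Nat.card (NCMatching n) = catalan n) ∧
    (fun n : ℕ => (narayana 1 n (n / 2) : ℝ) / (Nat.card (NCMatching n) : ℝ))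
      ~[atTop ⊓ 𝓟 {n : ℕ | Even n}] (fun n : ℕ => 2 / Real.sqrt (Real.pi * (n : ℝ))) := by
  refine ⟨fun n hn hev => ⟨fun C => ?_, card_ncMatching n⟩, ?_⟩
  · have := finite_ncMatching n
    obtain ⟨h, rfl⟩ := even_iff_exists_two_mul.1 hev
    refine ⟨Set.toFinite _, ?_⟩
    rw [Nat.mul_div_cancel_left h two_pos]
    exact ncard_supp_connectedComponent_le (by omega) C
  · simp only [card_ncMatching]
    exact narayana_div_catalan_isEquivalent
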